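/- **Theorem 5.23.** It is provable in $\mathbf{ZF}$ (equivalently: it holds in every model of $\mathbf{ZF}$) that the ultrafilter theorem $\mathbf{UFT}$, "for every set $S$, every proper filter of subsets of $S$ is contained in an ultrafilter on $S$", is equivalent to the statement > every weakly normal small generalized topological space has its Wallman strict compactification. Here the notions are as follows. *Generalized topological spaces.* A generalized topology in a set $X$ (in the sense of Delfs and Knebusch) is a collection $\mathrm{Cov}_X$ of families of subsets of $X$ such that, with $\mathrm{Op}_X=\bigcup\mathrm{Cov}_X$ (the open sets): finite families of open sets belong to $\mathrm{Cov}_X$, and their unions and their intersections (with $\bigcap\emptyset=X$) are open; if $V\in\mathrm{Op}_X$ and $\mathcal U\in\mathrm{Cov}_X$, then $\{V\cap U:U\in\mathcal U\}\in\mathrm{Cov}_X$; if $\mathcal U\in\mathrm{Cov}_X$ and $\Phi\subseteq\mathrm{Cov}_X$ satisfies $\{\bigcup\mathcal V:\mathcal V\in\Phi\}=\mathcal U$, then $\bigcup\Phi\in\mathrm{Cov}_X$; if $\mathcal U\in\mathrm{Cov}_X$, $\mathcal V\subseteq\mathrm{Op}_X$, $\bigcup\mathcal V=\bigcup\mathcal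 U$ and every member of $\mathcal U$ is contained in a member of $\mathcal V$, then $\mathcal V\in\mathrm{Cov}_X$; if $\mathcal U\in\mathrm{Cov}_X$, $V\subseteq\bigcup\mathcal U$ and $V\cap U\in\mathrm{Op}_X$ for all $U\in\mathcal U$, then $V\in\mathrm{Op}_X$. The pair $(X,\mathrm{Cov}_X)$ is then a generalized topological space (gts), and $\mathrm{Cl}_X=\{A\subseteq X: X\setminus A\in\mathrm{Op}_X\}$ is the collection of its closed sets. The gts is *small* if $\mathrm{Cov}_X$ consists of exactly those $\mathcal U\subseteq\mathrm{Op}_X$ for which some finite $\mathcal V\subseteq\mathcal U$ satisfies $\bigcup\mathcal V=\bigcup\mathcal U$. It is *weakly normal* if for all disjoint $A_1,A_2\subseteq X$, each of which is a singleton or a member of $\mathrm{Cl}_X$, there are disjoint $W_1,W_2\in\mathrm{Op}_X$ with $A_1\subseteq W_1$ and $A_2\subseteq W_2$. *Wallman space.* Let $\mathcal C=\mathrm{Cl}_X$. A filter in $\mathcal C$ is a non-empty $F\subseteq\mathcal C$ with $\emptyset\notin F$ that is closed under binary intersections and under supersets in $\mathcal C$; an ultrafilter in $\mathcal C$ is a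 maximal filter in $\mathcal C$. The Wallman space $\mathcal W=\mathcal W(X,\mathcal C)$ is the set of all ultrafilters in $\mathcal C$ with the topology $\tau$ that has the sets $[A]=\{p\in\mathcal W:A\in p\}$, $A\in\mathcal C$, as a closed base. Let $w(x)=\{A\in\mathcal C:x\in A\}$ for $x\in X$. *Wallman strict compactification.* For $U\in\mathrm{Op}_X$ let $\mathrm{Ex}(U)=\mathcal W\setminus\mathrm{cl}_{\mathcal W}\,w(X\setminus U)$, and let $\mathrm{Op}^w=\{\mathrm{Ex}(U):U\in\mathrm{Op}_X\}$. Let $\mathrm{Cov}^w$ be the collection of all families $\mathcal V\subseteq\mathrm{Op}^w$ of $\tau$-open sets $V$ with $w^{-1}(V)\in\mathrm{Op}_X$ such that $\{w^{-1}(V):V\in\mathcal V\}\in\mathrm{Cov}_X$. The weakly normal gts $X$ *has its Wallman strict compactification*, namely $(\mathcal W,\mathrm{Op}^w,\mathrm{Cov}^w)$, if the space $(\mathcal W,\tau)$ is compact (every open cover has a finite subcover) and $\mathrm{Cov}^w$ is a generalized topology in $\mathcal W$. -/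

import Mathlib

namespace InZF

/-! ### The language of set theory and models of ZF -/

/-- The only non-logical symbol of the language of set theory: binary membership. -/
inductive SetRel : ℕ → Type
  | mem : SetRel 2

/-- The first-order language of set theory. -/
def setLang : FirstOrder.Language.{0, 0} := ⟨fun _ => Empty, SetRel⟩

/-- The membership relation of a structure `M` for the language of set theory. -/
def Mem {M : Type*} [setLang.Structure M] (x y : M) : Prop :=
  FirstOrder.Language.Structure.RelMap (L := setLang) SetRel.mem ![x, y]

infix:50 " ∈ₘ " => Mem

section Basic

variable {M : Type*} [setLang.Structure M]

/-- `x ⊆ y`. -/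
def Subset (x y : M) : Prop := ∀ z, z ∈ₘ x → z ∈ₘ y

infix:50 " ⊆ₘ " => Subset

/-- `x = ∅`. -/
def IsEmptySet (x : M) : Prop := ∀ z, ¬ z ∈ₘ x

/-- `s = {a}`. -/
def IsSingleton (s a : M) : Prop := ∀ z, z ∈ₘ s ↔ z = a

/-- `s = {a, b}`. -/
def IsPair (s a b : M) : Prop := ∀ z, z ∈ₘ s ↔ z = a ∨ z = b

/-- `s = b ∪ {a}`. -/
def IsInsert (s a b : M) : Prop := ∀ z, z ∈ₘ s ↔ z = a ∨ z ∈ₘ b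

/-- `s = a ∩ b`. -/
def IsInter (s a b : M) : Prop := ∀ z, z ∈ₘ s ↔ z ∈ₘ a ∧ z ∈ₘ b

/-- `s = a \ b`. -/
def IsDiff (s a b : M) : Prop := ∀ z, z ∈ₘ s ↔ z ∈ₘ a ∧ ¬ z ∈ₘ b

/-- `s = ⋃ F`. -/
def IsSUnion (s F : M) : Prop := ∀ z, z ∈ₘ s ↔ ∃ y, y ∈ₘ F ∧ z ∈ₘ y

/-- `P` is the power set of `X`. -/
def IsPowerset (P X : M) : Prop := ∀ z, z ∈ₘ P ↔ z ⊆ₘ X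

/-- `a ∩ b = ∅`. -/
def IsDisjoint (a b : M) : Prop := ∀ z, ¬ (z ∈ₘ a ∧ z ∈ₘ b)

end Basic

/-- `M` is a model of Zermelo-Fraenkel set theory (without choice). The two schemes range over all
first-order formulas `φ` of the language of set theory, with the values `v` of the free
variables as parameters. -/
structure IsModelZF (M : Type*) [setLang.Structure M] : Prop where
  extensionality : ∀ x y : M, (∀ z, z ∈ₘ x ↔ z ∈ₘ y) → x = y
  foundation : ∀ x : M, (∃ y, y ∈ₘ x) → ∃ y, y ∈ₘ x ∧ IsDisjoint y x
  pairing : ∀ a b : M, ∃ s, IsPair s a b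
  union : ∀ F : M, ∃ s, IsSUnion s F
  powerset : ∀ X : M, ∃ P, IsPowerset P X
  infinity : ∃ w : M, (∃ e, e ∈ₘ w ∧ IsEmptySet e) ∧
    ∀ x, x ∈ₘ w → ∃ s, s ∈ₘ w ∧ IsInsert s x x
  separation : ∀ (φ : setLang.Formula ℕ) (v : ℕ → M) (a : M),
    ∃ b, ∀ x, x ∈ₘ b ↔ x ∈ₘ a ∧ φ.Realize (Function.update v 0 x)
  replacement : ∀ (φ : setLang.Formula ℕ) (v : ℕ → M) (a : M),
    (∀ x, x ∈ₘ a → ∃! y, φ.Realize (Function.update (Function.update v 0 x) 1 y)) →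
    ∃ b, ∀ y, y ∈ₘ b ↔
      ∃ x, x ∈ₘ a ∧ φ.Realize (Function.update (Function.update v 0 x) 1 y)

/-! From here on everything is a statement of the language of set theory about the elements of
a structure `M`: all quantifiers range over `M`. -/

section Internal

variable {M : Type*} [setLang.Structure M]

/-! ### Finiteness -/

/-- `A` is finite, by the inductive (Russell, Kuratowski) definition: `A` belongs to every collection
that contains `∅` and is closed under adjoining one element of `A`. In ZF this is the same as
being equipotent with a natural number. -/
def IsFinite (A : M) : Prop :=
  ∀ F : M, (∀ e, IsEmptySet e → e ∈ₘ F) →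
    (∀ B, B ∈ₘ F → ∀ a, a ∈ₘ A → ∀ B₁, IsInsert B₁ a B → B₁ ∈ₘ F) → A ∈ₘ F

/-- A family `𝒰` is essentially finite if some finite `𝒱 ⊆ 𝒰` has the same union. -/
def IsEssFinite (𝒰 : M) : Prop :=
  ∃ 𝒱, 𝒱 ⊆ₘ 𝒰 ∧ IsFinite 𝒱 ∧ ∃ S, IsSUnion S 𝒰 ∧ IsSUnion S 𝒱

/-! ### Generalized topological spaces -/

/-- `U ∈ Op = ⋃ Cov`. -/
def IsOp (Cov U : M) : Prop := ∃ 𝒰, 𝒰 ∈ₘ Cov ∧ U ∈ₘ 𝒰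

/-- `Cov` is a generalized topology in `X` (in the sense of Delfs and Knebusch), the collection of
open sets being `⋃ Cov`. -/
structure IsGenTop (X Cov : M) : Prop where
  subset : ∀ U, IsOp Cov U → U ⊆ₘ X
  /-- Finite families of open sets are admissible. -/
  finite_mem : ∀ 𝒰, IsFinite 𝒰 → (∀ U, U ∈ₘ 𝒰 → IsOp Cov U) → 𝒰 ∈ₘ Cov
  /-- Finite unions of open sets are open. -/
  finite_union : ∀ 𝒰, IsFinite 𝒰 → (∀ U, U ∈ₘ 𝒰 → IsOp Cov U) → ∀ S, IsSUnion S 𝒰 → IsOp Cov S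
  /-- Finite intersections in `X` of open sets are open; the empty intersection is `X`. -/
  finite_inter : ∀ 𝒰, IsFinite 𝒰 → (∀ U, U ∈ₘ 𝒰 → IsOp Cov U) →
    ∀ S, (∀ x, x ∈ₘ S ↔ x ∈ₘ X ∧ ∀ U, U ∈ₘ 𝒰 → x ∈ₘ U) → IsOp Cov S
  /-- If `V` is open and `𝒰` is admissible, then `{V ∩ U : U ∈ 𝒰}` is admissible. -/
  stability : ∀ V, IsOp Cov V → ∀ 𝒰, 𝒰 ∈ₘ Cov →
    ∀ 𝒲, (∀ W, W ∈ₘ 𝒲 ↔ ∃ U, U ∈ₘ 𝒰 ∧ IsInter W V U) → 𝒲 ∈ₘ Cov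
  /-- If `𝒰` is admissible and `Φ` consists of admissible coverings of members of `𝒰`, at least one
  for each member, then the family `⋃ Φ` is admissible. -/
  transitivity : ∀ 𝒰, 𝒰 ∈ₘ Cov → ∀ Φ, Φ ⊆ₘ Cov →
    (∀ U, U ∈ₘ 𝒰 → ∃ 𝒱, 𝒱 ∈ₘ Φ ∧ IsSUnion U 𝒱) →
    (∀ 𝒱, 𝒱 ∈ₘ Φ → ∃ U, U ∈ₘ 𝒰 ∧ IsSUnion U 𝒱) →
    ∀ 𝒲, IsSUnion 𝒲 Φ → 𝒲 ∈ₘ Cov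
  /-- A family of open sets that is refined by an admissible family with the same union is
  admissible. -/
  saturation : ∀ 𝒰, 𝒰 ∈ₘ Cov → ∀ 𝒱, (∀ V, V ∈ₘ 𝒱 → IsOp Cov V) →
    (∃ S, IsSUnion S 𝒰 ∧ IsSUnion S 𝒱) →
    (∀ U, U ∈ₘ 𝒰 → ∃ V, V ∈ₘ 𝒱 ∧ U ⊆ₘ V) → 𝒱 ∈ₘ Cov
  /-- A subset of the union of an admissible family is open if its traces on the members are. -/
  regularity : ∀ 𝒰, 𝒰 ∈ₘ Cov → ∀ V, (∀ x, x ∈ₘ V → ∃ U, U ∈ₘ 𝒰 ∧ x ∈ₘ U) →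
    (∀ U, U ∈ₘ 𝒰 → ∃ T, IsInter T V U ∧ IsOp Cov T) → IsOp Cov V

/-- `A ∈ Cl`, that is, `A ⊆ X` and `X \ A` is open. -/
def IsCl (X Cov A : M) : Prop := A ⊆ₘ X ∧ ∃ U, IsDiff U X A ∧ IsOp Cov U

/-- The gts is small: the admissible families are exactly the essentially finite families of
open sets. -/
def IsSmall (Cov : M) : Prop :=
  ∀ 𝒰, 𝒰 ∈ₘ Cov ↔ (∀ U, U ∈ₘ 𝒰 → IsOp Cov U) ∧ IsEssFinite 𝒰

/-- `A` is a singleton of a point of `X`, or a closed set. -/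
def IsPointOrCl (X Cov A : M) : Prop := (∃ x, x ∈ₘ X ∧ IsSingleton A x) ∨ IsCl X Cov A

/-- Weak normality: disjoint sets, each a singleton or closed, have disjoint open
neighbourhoods. -/
def IsWeaklyNormal (X Cov : M) : Prop :=
  ∀ A₁ A₂, IsPointOrCl X Cov A₁ → IsPointOrCl X Cov A₂ → IsDisjoint A₁ A₂ →
    ∃ W₁ W₂, IsOp Cov W₁ ∧ IsOp Cov W₂ ∧ IsDisjoint W₁ W₂ ∧ A₁ ⊆ₘ W₁ ∧ A₂ ⊆ₘ W₂

/-! ### Filters and ultrafilters in a ring of sets -/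

/-- `F` is a (proper) filter in the ring of sets `C`. -/
structure IsFilterIn (C F : M) : Prop where
  subset : F ⊆ₘ C
  nonempty : ∃ A, A ∈ₘ F
  proper : ∀ e, IsEmptySet e → ¬ e ∈ₘ F
  inter : ∀ A B, A ∈ₘ F → B ∈ₘ F → ∀ I, IsInter I A B → I ∈ₘ F
  upward : ∀ A B, A ∈ₘ F → B ∈ₘ C → A ⊆ₘ B → B ∈ₘ F

/-- `p` is an ultrafilter in `C`: a maximal filter in `C`. -/
def IsUltrafilterIn (C p : M) : Prop :=
  IsFilterIn C p ∧ ∀ F, IsFilterIn C F → p ⊆ₘ F → F ⊆ₘ p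

/-- The ultrafilter theorem, as a statement about the sets of `M`: every filter on a set is contained
in an ultrafilter on that set. -/
def UFT (M : Type*) [setLang.Structure M] : Prop :=
  ∀ X P : M, IsPowerset P X → ∀ F, IsFilterIn P F → ∃ p, IsUltrafilterIn P p ∧ F ⊆ₘ p

/-! ### The Wallman space -/

/-- `C = Cl_X` is the collection of all closed sets of the gts. -/
def IsClFamily (X Cov C : M) : Prop := ∀ A, A ∈ₘ C ↔ IsCl X Cov A

/-- `W = 𝒲(X, C)` is the set of all ultrafilters in `C`. -/
def IsWallmanSet (C W : M) : Prop := ∀ p, p ∈ₘ W ↔ IsUltrafilterIn C p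

/-- `ℬ` is the collection of the sets `[A] = {p ∈ W : A ∈ p}` with `A ∈ C`. -/
def IsWallmanBase (C W ℬ : M) : Prop :=
  ∀ B, B ∈ₘ ℬ ↔ ∃ A, A ∈ₘ C ∧ ∀ p, p ∈ₘ B ↔ p ∈ₘ W ∧ A ∈ₘ p

/-- `τ` is the topology in `W` that has `ℬ` as a closed base: `V` is open iff for every
point `p` of `V` some member of `ℬ` contains `W \ V` and not `p`. -/
def IsTopOfClosedBase (W ℬ τ : M) : Prop :=
  ∀ V, V ∈ₘ τ ↔ V ⊆ₘ W ∧
    ∀ p, p ∈ₘ V → ∃ B, B ∈ₘ ℬ ∧ ¬ p ∈ₘ B ∧ ∀ q, q ∈ₘ W → ¬ q ∈ₘ V → q ∈ₘ B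

/-- The topological space `(K, τ)` is compact. -/
def IsCompactSpace (K τ : M) : Prop :=
  ∀ 𝒱, 𝒱 ⊆ₘ τ → (∀ p, p ∈ₘ K → ∃ V, V ∈ₘ 𝒱 ∧ p ∈ₘ V) →
    ∃ 𝒰, 𝒰 ⊆ₘ 𝒱 ∧ IsFinite 𝒰 ∧ ∀ p, p ∈ₘ K → ∃ U, U ∈ₘ 𝒰 ∧ p ∈ₘ U

/-- The canonical map `w : X → 𝒲(X, C)`, given by `w x = {A ∈ C : x ∈ A}`, as the relation
`w x = p`. -/
def WallmanMap (C x p : M) : Prop := ∀ A, A ∈ₘ p ↔ A ∈ₘ C ∧ x ∈ₘ A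

/-! ### The Wallmanian part of a compactification

Here `(K, τ)` is a topological space and `α : X → K` a map, given as the relation `α x = p`. -/

/-- `P = α⁻¹(V)`. -/
def IsPreimage (X : M) (α : M → M → Prop) (V P : M) : Prop :=
  ∀ x, x ∈ₘ P ↔ x ∈ₘ X ∧ ∃ p, α x p ∧ p ∈ₘ V

/-- `V ∈ Op^S`: `V` is open in `K` and `α⁻¹(V)` is open in the gts `X`. -/
def IsOpS (X Cov τ : M) (α : M → M → Prop) (V : M) : Prop :=
  V ∈ₘ τ ∧ ∃ P, IsPreimage X α V P ∧ IsOp Cov P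

/-- `𝒱 ∈ Cov^S`: `𝒱 ⊆ Op^S` and the family `{α⁻¹(V) : V ∈ 𝒱}` is admissible in `X`. -/
def IsCovS (X Cov τ : M) (α : M → M → Prop) (𝒱 : M) : Prop :=
  (∀ V, V ∈ₘ 𝒱 → IsOpS X Cov τ α V) ∧
    ∃ 𝒬, 𝒬 ∈ₘ Cov ∧ ∀ P, P ∈ₘ 𝒬 ↔ ∃ V, V ∈ₘ 𝒱 ∧ IsPreimage X α V P

/-- `p` lies in the closure in `(K, τ)` of the image `α(S)`. -/
def InClosureImage (τ : M) (α : M → M → Prop) (S p : M) : Prop :=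
  ∀ V, V ∈ₘ τ → p ∈ₘ V → ∃ x, x ∈ₘ S ∧ ∃ q, α x q ∧ q ∈ₘ V

/-- `E = Ex(U) = K \ cl (α(X \ U))`. -/
def IsEx (X K τ : M) (α : M → M → Prop) (U E : M) : Prop :=
  ∃ S, IsDiff S X U ∧ ∀ p, p ∈ₘ E ↔ p ∈ₘ K ∧ ¬ InClosureImage τ α S p

/-- `V ∈ Op^w`: `V = Ex(U)` for some open set `U` of the gts `X`. -/
def IsOpW (X Cov K τ : M) (α : M → M → Prop) (V : M) : Prop :=
  ∃ U, IsOp Cov U ∧ IsEx X K τ α U V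

/-- `𝒦` is the collection `Cov^w = {𝒱 ∈ Cov^S : 𝒱 ⊆ Op^w}`. -/
def IsCovWFamily (X Cov K τ : M) (α : M → M → Prop) (𝒦 : M) : Prop :=
  ∀ 𝒱, 𝒱 ∈ₘ 𝒦 ↔ IsCovS X Cov τ α 𝒱 ∧ ∀ V, V ∈ₘ 𝒱 → IsOpW X Cov K τ α V

/-- The gts `(X, Cov)` has its Wallman strict compactification: its Wallman space `(W, τ)` is
compact, and the Wallmanian part `𝒦 = Cov^w` is a generalized topology in `W`. -/
def HasWallmanStrictCompactification (X Cov : M) : Prop :=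
  ∃ C W ℬ τ 𝒦, IsClFamily X Cov C ∧ IsWallmanSet C W ∧ IsWallmanBase C W ℬ ∧
    IsTopOfClosedBase W ℬ τ ∧ IsCompactSpace W τ ∧
    IsCovWFamily X Cov W τ (WallmanMap C) 𝒦 ∧ IsGenTop W 𝒦

end Internal

end InZF

/-!
For the forward implication let `C` be the ring of closed sets of a weakly normal small space `X`.
Weak normality makes `C` a normal ring (`IsNormalRing`), so the sets `w x` are ultrafilters in `C`.
In an arbitrary ring of sets the existence of maximal filters needs the axiom of choice, but in a
normal ring the ultrafilter theorem suffices: an ultrafilter on `X` induces a prime filter in `C`,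
and the closed sets that meet all its members form the unique maximal filter above it
(`IsNormalRing.exists_isUltrafilterIn`). This gives compactness of the Wallman space
(`IsWallmanSpace.isCompactSpace`). The closure of `w(A)` is `[A]` for closed `A`, so
`Ex(X \ A) = W \ [A]`, and `Ex` is an isomorphism from the lattice of open sets of `X` onto the ring
`Op^w`, with inverse `w⁻¹`. As `X` is small, `Cov^w` therefore consists of the essentially finite
families of members of `Op^w`, and the essentially finite families of members of any ring of sets
form a generalized topology (`IsRingOfSets.isGenTop`).

For the converse every set `X`, with the essentially finite families of its subsets, is a weakly
normal small space whose Wallman space is the space of ultrafilters on `X`; compactness of that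
space extends every filter on `X` to an ultrafilter (`uft_of_hasWallmanStrictCompactification`).

All of this happens inside a model `M` of ZF, which may have nonstandard natural numbers. So
finiteness is the finiteness of `M`, induction on finite sets (`IsFinite.induction`) is available
only for definable predicates, and sets are formed by separation for definable predicates
(`IsModelZF.sep`). The formulas that this requires are found by instance search for the class
`DefinableProp`, which reflects the closure of the first-order formulas with parameters under
connectives and quantifiers over `M`. Choices occur only over finite sets and are made by induction
(`IsFinite.exists_finite_subset`, `IsFinite.exists_finite_range`).
-/

namespace InZF

open FirstOrder

-- Instance search traverses whole formulas, which exceeds the default limits.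
set_option synthInstance.maxHeartbeats 200000
set_option synthInstance.maxSize 2000

/-! ### Definable predicates and separation -/

section Definability

variable {M : Type*} [setLang.Structure M]

/-- A predicate on assignments of the variables `0, 1, 2, …` that is given by a first-order formula
with parameters from `M`. A variable is `Sum.inl i`, a parameter is `Sum.inr c`. -/
def FormulaDefinable (Q : (ℕ → M) → Prop) : Prop :=
  ∃ φ : setLang.Formula (ℕ ⊕ M), ∀ v : ℕ → M, φ.Realize (Sum.elim v id) ↔ Q v

/-- `f` reads off one variable of the assignment, or is constant: the language has no function
symbols, so these are the values of its terms with parameters. -/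
def IsVarOrConst (f : (ℕ → M) → M) : Prop :=
  (∃ i : ℕ, ∀ v, f v = v i) ∨ ∃ c, ∀ v, f v = c

theorem IsVarOrConst.exists_term {f : (ℕ → M) → M} (hf : IsVarOrConst f) :
    ∃ t : setLang.Term (ℕ ⊕ M), ∀ v : ℕ → M, t.realize (Sum.elim v id) = f v := by
  rcases hf with ⟨i, hi⟩ | ⟨c, hc⟩
  · exact ⟨.var (.inl i), fun v => by simp [hi]⟩
  · exact ⟨.var (.inr c), fun v => by simp [hc]⟩

namespace FormulaDefinable

theorem mem {f g : (ℕ → M) → M} (hf : IsVarOrConst f) (hg : IsVarOrConst g) :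
    FormulaDefinable (fun v => f v ∈ₘ g v) := by
  obtain ⟨s, hs⟩ := hf.exists_term
  obtain ⟨t, ht⟩ := hg.exists_term
  refine ⟨Language.Relations.formula₂ (L := setLang) SetRel.mem s t, fun v => ?_⟩
  show _ ↔ f v ∈ₘ g v
  rw [← hs v, ← ht v]
  exact Language.Formula.realize_rel₂ (L := setLang) (R := SetRel.mem)

theorem eq {f g : (ℕ → M) → M} (hf : IsVarOrConst f) (hg : IsVarOrConst g) :
    FormulaDefinable (fun v => f v = g v) := by
  obtain ⟨s, hs⟩ := hf.exists_term
  obtain ⟨t, ht⟩ := hg.exists_term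
  refine ⟨s.equal t, fun v => ?_⟩
  rw [Language.Formula.realize_equal, hs, ht]

theorem not {P : (ℕ → M) → Prop} (hP : FormulaDefinable P) :
    FormulaDefinable (fun v => ¬ P v) := by
  obtain ⟨φ, hφ⟩ := hP
  exact ⟨φ.not, fun v => by rw [Language.Formula.realize_not, hφ]⟩

theorem and {P Q : (ℕ → M) → Prop} (hP : FormulaDefinable P) (hQ : FormulaDefinable Q) :
    FormulaDefinable (fun v => P v ∧ Q v) := by
  obtain ⟨φ, hφ⟩ := hP
  obtain ⟨ψ, hψ⟩ := hQ
  exact ⟨φ ⊓ ψ, fun v => by rw [Language.Formula.realize_inf, hφ, hψ]⟩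

/-- The quantified variable is the variable `0`; the other variables are shifted by one. -/
theorem ex {P : (ℕ → M) → M → Prop}
    (hP : FormulaDefinable (fun v => P (fun n => v (n + 1)) (v 0))) :
    FormulaDefinable (fun v => ∃ x, P v x) := by
  obtain ⟨φ, hφ⟩ := hP
  let σ : ℕ ⊕ M → (ℕ ⊕ M) ⊕ Unit :=
    Sum.elim (fun n => Nat.casesOn n (.inr ()) (fun k => .inl (.inl k))) (fun m => .inl (.inr m))
  refine ⟨(φ.relabel σ).iExs Unit, fun v => ?_⟩
  have key : ∀ i : Unit → M, (φ.relabel σ).Realize (Sum.elim (Sum.elim v id) i) ↔ P v (i ()) := by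
    intro i
    rw [Language.Formula.realize_relabel]
    have h := hφ (fun n => Nat.casesOn n (i ()) v)
    refine Iff.trans ?_ h
    apply iff_of_eq
    congr 1
    funext s
    rcases s with (_ | n) | m <;> rfl
  rw [Language.Formula.realize_iExs]
  constructor
  · rintro ⟨i, hi⟩
    exact ⟨i (), (key i).1 hi⟩
  · rintro ⟨x, hx⟩
    exact ⟨fun _ => x, (key _).2 hx⟩

end FormulaDefinable

/-- The separation scheme for formulas with arbitrary parameters. The axiom allows parameters only
as values of variables in `ℕ`, so the finitely many parameters of the formula are renumbered
`1, 2, …`, and all its variables become the variable `0`. -/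
theorem IsModelZF.separation_of_formulaDefinable (hM : IsModelZF M) {Q : M → Prop}
    (hQ : FormulaDefinable (fun v : ℕ → M => Q (v 0))) (a : M) :
    ∃ b, ∀ x, x ∈ₘ b ↔ x ∈ₘ a ∧ Q x := by
  classical
  obtain ⟨φ, hφ⟩ := hQ
  let e := φ.freeVarFinset.equivFin
  let f : φ.freeVarFinset → ℕ := fun s => if s.1.isLeft then 0 else e s + 1
  let w : ℕ → M := fun n =>
    if h : n - 1 < φ.freeVarFinset.card then
      Sum.elim (fun _ => a) id (e.symm ⟨n - 1, h⟩).1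
    else a
  obtain ⟨b, hb⟩ := hM.separation (φ.restrictFreeVar f) w a
  refine ⟨b, fun x => ?_⟩
  rw [hb x]
  refine and_congr_right fun _ => Iff.trans ?_ (hφ (fun _ => x))
  refine Language.BoundedFormula.realize_restrictFreeVar _ fun s => ?_
  rcases hs : s.1 with n | m
  · simp [f, hs]
  · simp [f, hs, w]

/-- An environment type `E`, in practice `Unit × M × ⋯ × M` nested to the left, holds the values of
the variables that are in scope. `IsCoord ρ` says that every component of `ρ v : E` is a variable
of the assignment `v` or a constant; this has to survive a renumbering of the variables, which
makes room for a bound variable. -/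
class EnvShape (M E : Type*) where
  IsCoord : ((ℕ → M) → E) → Prop
  shift : ∀ {ρ : (ℕ → M) → E}, IsCoord ρ → IsCoord (fun v => ρ (fun n => v (n + 1)))

instance : EnvShape M Unit := ⟨fun _ => True, fun _ => trivial⟩

instance {E : Type*} [EnvShape M E] : EnvShape M (E × M) where
  IsCoord ρ := EnvShape.IsCoord (fun v => (ρ v).1) ∧ IsVarOrConst (fun v => (ρ v).2)
  shift := by
    rintro ρ ⟨h₁, h₂⟩
    refine ⟨EnvShape.shift h₁, ?_⟩
    rcases h₂ with ⟨i, hi⟩ | ⟨c, hc⟩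
    · exact .inl ⟨i + 1, fun v => hi _⟩
    · exact .inr ⟨c, fun v => hc _⟩

variable {E E' : Type*} [EnvShape M E] [EnvShape M E']

variable (M) in
/-- `g` maps environments to environments by selecting components. -/
class IsEnvMap (g : E → E') : Prop where
  out : ∀ ρ : (ℕ → M) → E, EnvShape.IsCoord ρ → EnvShape.IsCoord (fun v => g (ρ v))

/-- `f` selects a component of the environment, or is constant. -/
class IsEnvTerm (f : E → M) : Prop where
  out : ∀ ρ : (ℕ → M) → E, EnvShape.IsCoord ρ → IsVarOrConst (fun v => f (ρ v))

variable (M) in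
/-- The predicate `P` of the values of the variables in scope is definable by a first-order formula
with parameters. As a class, so that instance search finds the formula by following the syntax of
`P`. -/
class DefinableProp (P : E → Prop) : Prop where
  out : ∀ ρ : (ℕ → M) → E, EnvShape.IsCoord ρ → FormulaDefinable (fun v => P (ρ v))

instance (priority := 2000) : IsEnvMap M (fun e : E => e) := ⟨fun _ h => h⟩

instance (g : E → E' × M) [h : IsEnvMap M g] : IsEnvMap M (fun e => (g e).1) :=
  ⟨fun ρ hρ => (h.out ρ hρ).1⟩

instance (g : E → E' × M) [h : IsEnvMap M g] : IsEnvTerm (fun e => (g e).2) :=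
  ⟨fun ρ hρ => (h.out ρ hρ).2⟩

instance (c : M) : IsEnvTerm (fun _ : E => c) := ⟨fun _ _ => .inr ⟨c, fun _ => rfl⟩⟩

-- This lets instance search weaken a term that is a variable of the context; it comes last since it
-- would otherwise be tried on every projection.
instance (priority := low) (f : E' → M) (g : E → E') [hf : IsEnvTerm f] [hg : IsEnvMap M g] :
    IsEnvTerm (fun e => f (g e)) :=
  ⟨fun ρ hρ => hf.out _ (hg.out ρ hρ)⟩

instance (f g : E → M) [hf : IsEnvTerm f] [hg : IsEnvTerm g] :
    DefinableProp M (fun e => f e ∈ₘ g e) :=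
  ⟨fun ρ hρ => .mem (hf.out ρ hρ) (hg.out ρ hρ)⟩

instance (f g : E → M) [hf : IsEnvTerm f] [hg : IsEnvTerm g] :
    DefinableProp M (fun e => f e = g e) :=
  ⟨fun ρ hρ => .eq (hf.out ρ hρ) (hg.out ρ hρ)⟩

instance (P : E → Prop) [h : DefinableProp M P] : DefinableProp M (fun e => ¬ P e) :=
  ⟨fun ρ hρ => (h.out ρ hρ).not⟩

instance (P Q : E → Prop) [h : DefinableProp M P] [h' : DefinableProp M Q] :
    DefinableProp M (fun e => P e ∧ Q e) :=
  ⟨fun ρ hρ => (h.out ρ hρ).and (h'.out ρ hρ)⟩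

instance (P : E → M → Prop) [h : DefinableProp M (fun e : E × M => P e.1 e.2)] :
    DefinableProp M (fun e => ∃ x, P e x) :=
  ⟨fun ρ hρ => .ex (h.out (fun v => (ρ (fun n => v (n + 1)), v 0))
    ⟨EnvShape.shift hρ, .inl ⟨0, fun _ => rfl⟩⟩)⟩

theorem DefinableProp.congr {P Q : E → Prop} (h : DefinableProp M P) (hPQ : ∀ e, P e ↔ Q e) :
    DefinableProp M Q :=
  (funext fun e => propext (hPQ e) : P = Q) ▸ h

instance (P Q : E → Prop) [DefinableProp M P] [DefinableProp M Q] :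
    DefinableProp M (fun e => P e → Q e) :=
  DefinableProp.congr (P := fun e => ¬ (P e ∧ ¬ Q e)) inferInstance fun _ => by tauto

instance (P Q : E → Prop) [DefinableProp M P] [DefinableProp M Q] :
    DefinableProp M (fun e => P e ∨ Q e) :=
  DefinableProp.congr (P := fun e => ¬ (¬ P e ∧ ¬ Q e)) inferInstance fun _ => by tauto

instance (P Q : E → Prop) [DefinableProp M P] [DefinableProp M Q] :
    DefinableProp M (fun e => P e ↔ Q e) :=
  DefinableProp.congr (P := fun e => (P e → Q e) ∧ (Q e → P e)) inferInstance fun _ => by tauto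

instance (P : E → M → Prop) [DefinableProp M (fun e : E × M => P e.1 e.2)] :
    DefinableProp M (fun e => ∀ x, P e x) :=
  DefinableProp.congr (P := fun e => ¬ ∃ x, ¬ P e x) inferInstance fun _ => by simp

/-- The separation scheme, with the formula found by instance search. -/
theorem IsModelZF.sep (hM : IsModelZF M) (a : M) (Q : M → Prop)
    [h : DefinableProp M (fun e : Unit × M => Q e.2)] : ∃ b, ∀ x, x ∈ₘ b ↔ x ∈ₘ a ∧ Q x :=
  hM.separation_of_formulaDefinable
    (h.out (fun v => ((), v 0)) ⟨trivial, .inl ⟨0, fun _ => rfl⟩⟩) a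

section Instances
variable (f g k l : E → M) [IsEnvTerm f] [IsEnvTerm g] [IsEnvTerm k] [IsEnvTerm l]

instance : DefinableProp M (fun e => f e ⊆ₘ g e) := by unfold Subset; infer_instance
instance : DefinableProp M (fun e => IsEmptySet (f e)) := by unfold IsEmptySet; infer_instance
instance : DefinableProp M (fun e => IsInsert (f e) (g e) (k e)) := by
  unfold IsInsert; infer_instance
instance : DefinableProp M (fun e => IsInter (f e) (g e) (k e)) := by unfold IsInter; infer_instance
instance : DefinableProp M (fun e => IsDiff (f e) (g e) (k e)) := by unfold IsDiff; infer_instance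
instance : DefinableProp M (fun e => IsDisjoint (f e) (g e)) := by unfold IsDisjoint; infer_instance
instance : DefinableProp M (fun e => IsSUnion (f e) (g e)) := by unfold IsSUnion; infer_instance
instance : DefinableProp M (fun e => IsFinite (f e)) := by unfold IsFinite; infer_instance
instance : DefinableProp M (fun e => IsEssFinite (f e)) := by unfold IsEssFinite; infer_instance
instance : DefinableProp M (fun e => IsOp (f e) (g e)) := by unfold IsOp; infer_instance
instance : DefinableProp M (fun e => IsCl (f e) (g e) (k e)) := by unfold IsCl; infer_instance

instance : DefinableProp M (fun e => IsFilterIn (f e) (g e)) :=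
  DefinableProp.congr (P := fun e => g e ⊆ₘ f e ∧ (∃ A, A ∈ₘ g e) ∧
    (∀ a, IsEmptySet a → ¬ a ∈ₘ g e) ∧
    (∀ A B, A ∈ₘ g e → B ∈ₘ g e → ∀ I, IsInter I A B → I ∈ₘ g e) ∧
    (∀ A B, A ∈ₘ g e → B ∈ₘ f e → A ⊆ₘ B → B ∈ₘ g e)) inferInstance
    fun _ => ⟨fun ⟨a, b, c, d, h⟩ => ⟨a, b, c, d, h⟩, fun ⟨a, b, c, d, h⟩ => ⟨a, b, c, d, h⟩⟩

instance : DefinableProp M (fun e => IsUltrafilterIn (f e) (g e)) := by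
  unfold IsUltrafilterIn; infer_instance

end Instances

end Definability

/-! ### Basic sets and finiteness -/

section Sets

variable {M : Type*} [setLang.Structure M]

/-- `s = a ∪ b`. -/
def IsUnion (s a b : M) : Prop := ∀ z, z ∈ₘ s ↔ z ∈ₘ a ∨ z ∈ₘ b

instance {E : Type*} [EnvShape M E] (f g k : E → M) [IsEnvTerm f] [IsEnvTerm g] [IsEnvTerm k] :
    DefinableProp M (fun e => IsUnion (f e) (g e) (k e)) := by unfold IsUnion; infer_instance

/-- A definable relation, given in the two-variable context, stays definable after substitution of
terms in any context. -/
theorem DefinableProp.rel {R : M → M → Prop}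
    (h : DefinableProp M (fun e : (Unit × M) × M => R e.1.2 e.2))
    {E : Type*} [EnvShape M E] (f g : E → M) [hf : IsEnvTerm f] [hg : IsEnvTerm g] :
    DefinableProp M (fun e => R (f e) (g e)) :=
  ⟨fun ρ hρ => h.out (fun v => (((), f (ρ v)), g (ρ v)))
    ⟨⟨trivial, hf.out ρ hρ⟩, hg.out ρ hρ⟩⟩

namespace IsModelZF

variable (hM : IsModelZF M)
include hM

theorem exists_empty : ∃ e : M, IsEmptySet e := by
  obtain ⟨_, ⟨e, _, he⟩, _⟩ := hM.infinity
  exact ⟨e, he⟩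

theorem exists_singleton (a : M) : ∃ s, IsSingleton s a := by
  obtain ⟨s, hs⟩ := hM.pairing a a
  exact ⟨s, fun z => by rw [hs z, or_self]⟩

theorem exists_union (a b : M) : ∃ s, IsUnion s a b := by
  obtain ⟨p, hp⟩ := hM.pairing a b
  obtain ⟨s, hs⟩ := hM.union p
  refine ⟨s, fun z => ?_⟩
  rw [hs z]
  constructor
  · rintro ⟨y, hy, hz⟩
    rcases (hp y).1 hy with rfl | rfl
    exacts [.inl hz, .inr hz]
  · rintro (h | h)
    exacts [⟨a, (hp a).2 (.inl rfl), h⟩, ⟨b, (hp b).2 (.inr rfl), h⟩]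

theorem exists_inter (a b : M) : ∃ s, IsInter s a b := hM.sep a (fun z => z ∈ₘ b)

theorem exists_diff (a b : M) : ∃ s, IsDiff s a b := hM.sep a (fun z => ¬ z ∈ₘ b)

end IsModelZF

theorem isFinite_of_isEmptySet {A : M} (hA : IsEmptySet A) : IsFinite A :=
  fun _ h _ => h A hA

theorem IsFinite.insert {B B₁ a : M} (hB : IsFinite B) (h : IsInsert B₁ a B) : IsFinite B₁ :=
  fun F h₀ h₁ => h₁ B (hB F h₀ fun C hC b hb => h₁ C hC b ((h b).2 (.inr hb))) a
    ((h a).2 (.inl rfl)) B₁ h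

theorem isFinite_of_isSingleton {s a : M} (hM : IsModelZF M) (h : IsSingleton s a) :
    IsFinite s := by
  obtain ⟨e, he⟩ := hM.exists_empty
  refine (isFinite_of_isEmptySet he).insert (a := a) fun z => ?_
  rw [h z]
  exact ⟨.inl, fun h => h.resolve_right (he z)⟩

/-- Induction on finite sets for definable predicates, along subsets of the given set. -/
theorem IsFinite.induction (hM : IsModelZF M) {A : M} (hA : IsFinite A) (P : M → Prop)
    [DefinableProp M (fun e : Unit × M => P e.2)] (empty : ∀ e, IsEmptySet e → P e)
    (insert : ∀ B a B₁, B ⊆ₘ A → a ∈ₘ A → IsInsert B₁ a B → P B → P B₁) : P A := by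
  obtain ⟨Q, hQ⟩ := hM.powerset A
  obtain ⟨F, hF⟩ := hM.sep Q P
  refine ((hF A).1 (hA F ?_ ?_)).2
  · exact fun e he => (hF e).2 ⟨(hQ e).2 fun z hz => (he z hz).elim, empty e he⟩
  · intro B hB a ha B₁ hB₁
    obtain ⟨h₁, h₂⟩ := (hF B).1 hB
    have hBA := (hQ B).1 h₁
    refine (hF B₁).2 ⟨(hQ B₁).2 fun z hz => ?_, insert B a B₁ hBA ha hB₁ h₂⟩
    rcases (hB₁ z).1 hz with rfl | hz
    exacts [ha, hBA z hz]

theorem IsFinite.union (hM : IsModelZF M) {A B : M} (hA : IsFinite A) (hB : IsFinite B) {D : M}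
    (hD : IsUnion D A B) : IsFinite D := by
  refine hB.induction hM (fun B => ∀ D, IsUnion D A B → IsFinite D) ?_ ?_ D hD
  · intro e he D hD
    have : D = A := hM.extensionality _ _ fun z => by simp [hD z, he z]
    exact this ▸ hA
  · intro B a B₁ _ _ hB₁ ih D hD
    obtain ⟨C, hC⟩ := hM.exists_union A B
    refine (ih C hC).insert (a := a) fun z => ?_
    rw [hD z, hB₁ z, hC z]
    tauto

/-- Finitely many witnesses can be chosen in a finite set without the axiom of choice; a witness
for `U` is here a finite set `𝒱`, and enlarging `𝒱` is harmless. -/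
theorem IsFinite.exists_finite_subset (hM : IsModelZF M) {A : M} (hA : IsFinite A) (𝒲 : M)
    (Q : M → M → Prop) [hQ : DefinableProp M (fun e : (Unit × M) × M => Q e.1.2 e.2)]
    (mono : ∀ U 𝒱 𝒱', 𝒱 ⊆ₘ 𝒱' → Q U 𝒱 → Q U 𝒱')
    (h : ∀ U, U ∈ₘ A → ∃ 𝒱, 𝒱 ⊆ₘ 𝒲 ∧ IsFinite 𝒱 ∧ Q U 𝒱) :
    ∃ 𝒱, 𝒱 ⊆ₘ 𝒲 ∧ IsFinite 𝒱 ∧ ∀ U, U ∈ₘ A → Q U 𝒱 := by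
  have inst : DefinableProp M (fun e : ((Unit × M) × M) × M => Q e.2 e.1.2) := hQ.rel _ _
  refine hA.induction hM
    (fun B => ∃ 𝒱, 𝒱 ⊆ₘ 𝒲 ∧ IsFinite 𝒱 ∧ ∀ U, U ∈ₘ B → Q U 𝒱) ?_ ?_
  · intro e he
    exact ⟨e, fun z hz => (he z hz).elim, isFinite_of_isEmptySet he, fun z hz => (he z hz).elim⟩
  · rintro B a B₁ _ ha hB₁ ⟨𝒱, h₁, h₂, h₃⟩
    obtain ⟨𝒱', h₁', h₂', h₃'⟩ := h a ha
    obtain ⟨𝒟, h𝒟⟩ := hM.exists_union 𝒱 𝒱'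
    refine ⟨𝒟, fun z hz => ((h𝒟 z).1 hz).elim (h₁ z) (h₁' z), h₂.union hM h₂' h𝒟, fun U hU => ?_⟩
    rcases (hB₁ U).1 hU with rfl | hU
    · exact mono U _ _ (fun z hz => (h𝒟 z).2 (.inr hz)) h₃'
    · exact mono U _ _ (fun z hz => (h𝒟 z).2 (.inl hz)) (h₃ U hU)

/-- Finite choice in collection form: finitely many members of `𝒲` serve as witnesses for all
members of the finite set `A`. -/
theorem IsFinite.exists_finite_range (hM : IsModelZF M) {A : M} (hA : IsFinite A) (𝒲 : M)
    (Q : M → M → Prop) [hQ : DefinableProp M (fun e : (Unit × M) × M => Q e.1.2 e.2)]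
    (h : ∀ U, U ∈ₘ A → ∃ V, V ∈ₘ 𝒲 ∧ Q U V) :
    ∃ 𝒱, 𝒱 ⊆ₘ 𝒲 ∧ IsFinite 𝒱 ∧ ∀ U, U ∈ₘ A → ∃ V, V ∈ₘ 𝒱 ∧ Q U V := by
  have inst : DefinableProp M (fun e : ((Unit × M) × M) × M => Q e.1.1.2 e.2) := hQ.rel _ _
  refine hA.exists_finite_subset hM 𝒲 (fun U 𝒱 => ∃ V, V ∈ₘ 𝒱 ∧ Q U V) ?_ ?_
  · rintro U 𝒱 𝒱' h ⟨V, hV, hUV⟩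
    exact ⟨V, h V hV, hUV⟩
  · intro U hU
    obtain ⟨V, hV, hUV⟩ := h U hU
    obtain ⟨s, hs⟩ := hM.exists_singleton V
    exact ⟨s, fun z hz => (hs z).1 hz ▸ hV, isFinite_of_isSingleton hM hs, V, (hs V).2 rfl, hUV⟩

/-- `U ⊆ ⋃ 𝒱`. -/
def IsCoveredBy (U 𝒱 : M) : Prop := ∀ x, x ∈ₘ U → ∃ V, V ∈ₘ 𝒱 ∧ x ∈ₘ V

instance {E : Type*} [EnvShape M E] (f g : E → M) [IsEnvTerm f] [IsEnvTerm g] :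
    DefinableProp M (fun e => IsCoveredBy (f e) (g e)) := by unfold IsCoveredBy; infer_instance

theorem isEssFinite_iff (hM : IsModelZF M) {𝒰 : M} :
    IsEssFinite 𝒰 ↔ ∃ 𝒱, 𝒱 ⊆ₘ 𝒰 ∧ IsFinite 𝒱 ∧ ∀ U, U ∈ₘ 𝒰 → IsCoveredBy U 𝒱 := by
  constructor
  · rintro ⟨𝒱, h₁, h₂, S, hS, hS'⟩
    exact ⟨𝒱, h₁, h₂, fun U hU x hx => (hS' x).1 ((hS x).2 ⟨U, hU, hx⟩)⟩
  · rintro ⟨𝒱, h₁, h₂, h₃⟩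
    obtain ⟨S, hS⟩ := hM.union 𝒰
    refine ⟨𝒱, h₁, h₂, S, hS, fun x => (hS x).trans ⟨?_, ?_⟩⟩
    · rintro ⟨U, hU, hx⟩
      exact h₃ U hU x hx
    · rintro ⟨V, hV, hx⟩
      exact ⟨V, h₁ V hV, hx⟩

theorem IsFinite.isEssFinite (hM : IsModelZF M) {𝒰 : M} (h : IsFinite 𝒰) : IsEssFinite 𝒰 :=
  (isEssFinite_iff hM).2 ⟨𝒰, fun _ h => h, h, fun U hU _ hx => ⟨U, hU, hx⟩⟩

/-- Essential finiteness passes from `𝒰` to `𝒲` if the unions agree and each member of `𝒰` has a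
finite covering by members of `𝒲`. -/
theorem IsEssFinite.of_isCoveredBy (hM : IsModelZF M) {𝒰 𝒲 : M} (h : IsEssFinite 𝒰)
    (h₁ : ∀ U, U ∈ₘ 𝒰 → ∃ 𝒱, 𝒱 ⊆ₘ 𝒲 ∧ IsFinite 𝒱 ∧ IsCoveredBy U 𝒱)
    (h₂ : ∀ W, W ∈ₘ 𝒲 → IsCoveredBy W 𝒰) : IsEssFinite 𝒲 := by
  obtain ⟨𝒰₀, h𝒰₀, hfin, hcov⟩ := (isEssFinite_iff hM).1 h
  obtain ⟨𝒱, h𝒱, h𝒱fin, h𝒱cov⟩ := hfin.exists_finite_subset hM 𝒲 IsCoveredBy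
    (fun U 𝒱 𝒱' h hU x hx => (hU x hx).imp fun V hV => ⟨h V hV.1, hV.2⟩)
    (fun U hU => h₁ U (h𝒰₀ U hU))
  refine (isEssFinite_iff hM).2 ⟨𝒱, h𝒱, h𝒱fin, fun W hW x hx => ?_⟩
  obtain ⟨U, hU, hxU⟩ := h₂ W hW x hx
  obtain ⟨U', hU', hxU'⟩ := hcov U hU x hxU
  exact h𝒱cov U' hU' x hxU'

/-! ### Rings of sets -/

/-- `R` is a ring of subsets of `X` that contains `∅` and `X`, that is, a bounded sublattice of the
power set. -/
structure IsRingOfSets (X R : M) : Prop where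
  subset : ∀ U, U ∈ₘ R → U ⊆ₘ X
  empty : ∀ e, IsEmptySet e → e ∈ₘ R
  univ : X ∈ₘ R
  union : ∀ U V, U ∈ₘ R → V ∈ₘ R → ∀ S, IsUnion S U V → S ∈ₘ R
  inter : ∀ U V, U ∈ₘ R → V ∈ₘ R → ∀ S, IsInter S U V → S ∈ₘ R

theorem IsRingOfSets.finite_union (hM : IsModelZF M) {X R 𝒰 S : M} (hR : IsRingOfSets X R)
    (h : IsFinite 𝒰) (h𝒰 : 𝒰 ⊆ₘ R) (hS : IsSUnion S 𝒰) : S ∈ₘ R := by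
  refine h.induction hM (fun B => ∀ S, IsSUnion S B → S ∈ₘ R) ?_ ?_ S hS
  · exact fun e he S hS => hR.empty S fun z hz => by
      obtain ⟨y, hy, _⟩ := (hS z).1 hz
      exact he y hy
  · intro B a B₁ _ ha hB₁ ih S hS
    obtain ⟨T, hT⟩ := hM.union B
    refine hR.union a T (h𝒰 a ha) (ih T hT) S fun z => ?_
    rw [hS z, hT z]
    constructor
    · rintro ⟨y, hy, hz⟩
      rcases (hB₁ y).1 hy with rfl | hy
      exacts [.inl hz, .inr ⟨y, hy, hz⟩]
    · rintro (hz | ⟨y, hy, hz⟩)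
      exacts [⟨a, (hB₁ a).2 (.inl rfl), hz⟩, ⟨y, (hB₁ y).2 (.inr hy), hz⟩]

theorem IsRingOfSets.finite_inter (hM : IsModelZF M) {X R 𝒰 S : M} (hR : IsRingOfSets X R)
    (h : IsFinite 𝒰) (h𝒰 : 𝒰 ⊆ₘ R)
    (hS : ∀ x, x ∈ₘ S ↔ x ∈ₘ X ∧ ∀ U, U ∈ₘ 𝒰 → x ∈ₘ U) : S ∈ₘ R := by
  refine h.induction hM
    (fun B => ∀ S, (∀ x, x ∈ₘ S ↔ x ∈ₘ X ∧ ∀ U, U ∈ₘ B → x ∈ₘ U) → S ∈ₘ R) ?_ ?_ S hS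
  · intro e he S hS
    have : S = X := hM.extensionality _ _ fun z =>
      (hS z).trans ⟨fun h => h.1, fun h => ⟨h, fun U hU => (he U hU).elim⟩⟩
    exact this ▸ hR.univ
  · intro B a B₁ _ ha hB₁ ih S hS
    obtain ⟨T, hT⟩ := hM.sep X (fun x => ∀ U, U ∈ₘ B → x ∈ₘ U)
    refine hR.inter a T (h𝒰 a ha) (ih T hT) S fun z => ?_
    rw [hS z, hT z]
    constructor
    · rintro ⟨hz, h⟩
      exact ⟨h a ((hB₁ a).2 (.inl rfl)), hz, fun U hU => h U ((hB₁ U).2 (.inr hU))⟩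
    · rintro ⟨hza, hz, h⟩
      refine ⟨hz, fun U hU => ?_⟩
      rcases (hB₁ U).1 hU with rfl | hU
      exacts [hza, h U hU]

theorem isOp_iff_mem (hM : IsModelZF M) {R Cov : M}
    (h : ∀ 𝒰, 𝒰 ∈ₘ Cov ↔ 𝒰 ⊆ₘ R ∧ IsEssFinite 𝒰) (U : M) : IsOp Cov U ↔ U ∈ₘ R := by
  constructor
  · rintro ⟨𝒰, h𝒰, hU⟩
    exact ((h 𝒰).1 h𝒰).1 U hU
  · intro hU
    obtain ⟨s, hs⟩ := hM.exists_singleton U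
    exact ⟨s, (h s).2 ⟨fun z hz => (hs z).1 hz ▸ hU,
      (isFinite_of_isSingleton hM hs).isEssFinite hM⟩, (hs U).2 rfl⟩

/-- The essentially finite families of members of a ring of sets form a generalized topology; both
the discrete space and `Cov^w` arise in this way. -/
theorem IsRingOfSets.isGenTop (hM : IsModelZF M) {X R Cov : M} (hR : IsRingOfSets X R)
    (h : ∀ 𝒰, 𝒰 ∈ₘ Cov ↔ 𝒰 ⊆ₘ R ∧ IsEssFinite 𝒰) : IsGenTop X Cov := by
  have hop := isOp_iff_mem hM h
  constructor
  · exact fun U hU => hR.subset U ((hop U).1 hU)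
  · exact fun 𝒰 hfin h𝒰 => (h 𝒰).2 ⟨fun U hU => (hop U).1 (h𝒰 U hU), hfin.isEssFinite hM⟩
  · exact fun 𝒰 hfin h𝒰 S hS =>
      (hop S).2 (hR.finite_union hM hfin (fun U hU => (hop U).1 (h𝒰 U hU)) hS)
  · exact fun 𝒰 hfin h𝒰 S hS =>
      (hop S).2 (hR.finite_inter hM hfin (fun U hU => (hop U).1 (h𝒰 U hU)) hS)
  · intro V hV 𝒰 h𝒰 𝒲 h𝒲
    obtain ⟨h𝒰R, hess⟩ := (h 𝒰).1 h𝒰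
    refine (h 𝒲).2 ⟨fun W hW => ?_, ?_⟩
    · obtain ⟨U, hU, hW⟩ := (h𝒲 W).1 hW
      exact hR.inter V U ((hop V).1 hV) (h𝒰R U hU) W hW
    · obtain ⟨𝒰₀, h𝒰₀, hfin, hcov⟩ := (isEssFinite_iff hM).1 hess
      obtain ⟨𝒱, h𝒱, h𝒱fin, h𝒱cov⟩ := hfin.exists_finite_range hM 𝒲 (fun U W => IsInter W V U)
        (fun U hU => by
          obtain ⟨W, hW⟩ := hM.exists_inter V U
          exact ⟨W, (h𝒲 W).2 ⟨U, h𝒰₀ U hU, hW⟩, hW⟩)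
      refine (isEssFinite_iff hM).2 ⟨𝒱, h𝒱, h𝒱fin, fun W hW x hx => ?_⟩
      obtain ⟨U, hU, hWU⟩ := (h𝒲 W).1 hW
      obtain ⟨hxV, hxU⟩ := (hWU x).1 hx
      obtain ⟨U', hU', hxU'⟩ := hcov U hU x hxU
      obtain ⟨W', hW', hWU'⟩ := h𝒱cov U' hU'
      exact ⟨W', hW', (hWU' x).2 ⟨hxV, hxU'⟩⟩
  · intro 𝒰 h𝒰 Φ hΦ h₁ h₂ 𝒲 h𝒲
    refine (h 𝒲).2 ⟨fun W hW => ?_, ((h 𝒰).1 h𝒰).2.of_isCoveredBy hM (fun U hU => ?_) ?_⟩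
    · obtain ⟨𝒱, h𝒱, hW⟩ := (h𝒲 W).1 hW
      exact ((h 𝒱).1 (hΦ 𝒱 h𝒱)).1 W hW
    · obtain ⟨𝒱, h𝒱, hU⟩ := h₁ U hU
      obtain ⟨𝒱₀, h𝒱₀, hfin, hcov⟩ := (isEssFinite_iff hM).1 ((h 𝒱).1 (hΦ 𝒱 h𝒱)).2
      refine ⟨𝒱₀, fun V hV => (h𝒲 V).2 ⟨𝒱, h𝒱, h𝒱₀ V hV⟩, hfin, fun x hx => ?_⟩
      obtain ⟨V, hV, hxV⟩ := (hU x).1 hx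
      exact hcov V hV x hxV
    · intro W hW x hx
      obtain ⟨𝒱, h𝒱, hW⟩ := (h𝒲 W).1 hW
      obtain ⟨U, hU, hU𝒱⟩ := h₂ 𝒱 h𝒱
      exact ⟨U, hU, (hU𝒱 x).2 ⟨W, hW, hx⟩⟩
  · rintro 𝒰 h𝒰 𝒱 h𝒱 ⟨S, hS, hS'⟩ href
    refine (h 𝒱).2 ⟨fun V hV => (hop V).1 (h𝒱 V hV),
      ((h 𝒰).1 h𝒰).2.of_isCoveredBy hM (fun U hU => ?_) ?_⟩
    · obtain ⟨V, hV, hUV⟩ := href U hU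
      obtain ⟨s, hs⟩ := hM.exists_singleton V
      exact ⟨s, fun z hz => (hs z).1 hz ▸ hV, isFinite_of_isSingleton hM hs,
        fun x hx => ⟨V, (hs V).2 rfl, hUV x hx⟩⟩
    · exact fun W hW x hx => (hS x).1 ((hS' x).2 ⟨W, hW, hx⟩)
  · intro 𝒰 h𝒰 V hV htr
    obtain ⟨𝒰₀, h𝒰₀, hfin, hcov⟩ := (isEssFinite_iff hM).1 ((h 𝒰).1 h𝒰).2
    -- The traces are chosen among the members of `R` inside `V`, so that their union is `V`.
    obtain ⟨R', hR'⟩ := hM.sep R (fun T => T ⊆ₘ V)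
    obtain ⟨𝒱, h𝒱, h𝒱fin, h𝒱cov⟩ := hfin.exists_finite_range hM R' (fun U T => IsInter T V U)
      (fun U hU => by
        obtain ⟨T, hT, hTop⟩ := htr U (h𝒰₀ U hU)
        exact ⟨T, (hR' T).2 ⟨(hop T).1 hTop, fun z hz => ((hT z).1 hz).1⟩, hT⟩)
    refine (hop V).2 (hR.finite_union hM h𝒱fin (fun T hT => ((hR' T).1 (h𝒱 T hT)).1) fun x =>
      ⟨fun hx => ?_, fun ⟨T, hT, hx⟩ => ((hR' T).1 (h𝒱 T hT)).2 x hx⟩)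
    obtain ⟨U, hU, hxU⟩ := hV x hx
    obtain ⟨U', hU', hxU'⟩ := hcov U hU x hxU
    obtain ⟨T, hT, hTU⟩ := h𝒱cov U' hU'
    exact ⟨T, hT, (hTU x).2 ⟨hx, hxU'⟩⟩

theorem IsModelZF.exists_essFinite_families (hM : IsModelZF M) (R : M) :
    ∃ Cov, ∀ 𝒰, 𝒰 ∈ₘ Cov ↔ 𝒰 ⊆ₘ R ∧ IsEssFinite 𝒰 := by
  obtain ⟨P, hP⟩ := hM.powerset R
  obtain ⟨Cov, hCov⟩ := hM.sep P IsEssFinite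
  exact ⟨Cov, fun 𝒰 => by rw [hCov, hP]⟩

end Sets

/-! ### Normal rings of closed sets -/

section Filters

variable {M : Type*} [setLang.Structure M]

/-- A ring of (closed) subsets of `X` that separates points from disjoint members, and is normal:
disjoint members `A`, `B` have complementary neighbourhoods, here given by their complements
`A'`, `B'`, which cover `X`. -/
structure IsNormalRing (X C : M) : Prop extends IsRingOfSets X C where
  separates : ∀ x A, x ∈ₘ X → A ∈ₘ C → ¬ x ∈ₘ A → ∃ B, B ∈ₘ C ∧ x ∈ₘ B ∧ IsDisjoint A B
  normal : ∀ A B, A ∈ₘ C → B ∈ₘ C → IsDisjoint A B → ∃ A' B', A' ∈ₘ C ∧ B' ∈ₘ C ∧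
    IsDisjoint A A' ∧ IsDisjoint B B' ∧ IsUnion X A' B'

theorem isSUnion_of_isPair {a b s S : M} (hs : IsPair s a b) (hS : IsUnion S a b) :
    IsSUnion S s := by
  intro z
  rw [hS z]
  constructor
  · rintro (hz | hz)
    exacts [⟨a, (hs a).2 (.inl rfl), hz⟩, ⟨b, (hs b).2 (.inr rfl), hz⟩]
  · rintro ⟨y, hy, hz⟩
    rcases (hs y).1 hy with rfl | rfl
    exacts [.inl hz, .inr hz]

theorem isFinite_of_isPair (hM : IsModelZF M) {a b s : M} (hs : IsPair s a b) : IsFinite s := by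
  obtain ⟨t, ht⟩ := hM.exists_singleton b
  exact (isFinite_of_isSingleton hM ht).insert (a := a) fun z => by rw [hs z, ht z]

namespace IsGenTop

variable {X Cov : M} (hX : IsGenTop X Cov) (hM : IsModelZF M)
include hX

theorem isOp_of_isEmptySet {e : M} (he : IsEmptySet e) : IsOp Cov e :=
  hX.finite_union e (isFinite_of_isEmptySet he) (fun U hU => (he U hU).elim) e
    fun z => ⟨fun h => (he z h).elim, fun ⟨y, hy, _⟩ => (he y hy).elim⟩

include hM

theorem isOp_univ : IsOp Cov X := by
  obtain ⟨e, he⟩ := hM.exists_empty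
  exact hX.finite_inter e (isFinite_of_isEmptySet he) (fun U hU => (he U hU).elim) X
    fun z => ⟨fun h => ⟨h, fun U hU => (he U hU).elim⟩, fun h => h.1⟩

theorem isOp_union {U V S : M} (hU : IsOp Cov U) (hV : IsOp Cov V) (hS : IsUnion S U V) :
    IsOp Cov S := by
  obtain ⟨s, hs⟩ := hM.pairing U V
  refine hX.finite_union s (isFinite_of_isPair hM hs) (fun T hT => ?_) S (isSUnion_of_isPair hs hS)
  rcases (hs T).1 hT with rfl | rfl
  exacts [hU, hV]

theorem isOp_inter {U V S : M} (hU : IsOp Cov U) (hV : IsOp Cov V) (hS : IsInter S U V) :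
    IsOp Cov S := by
  obtain ⟨s, hs⟩ := hM.pairing U V
  refine hX.finite_inter s (isFinite_of_isPair hM hs) (fun T hT => ?_) S fun x => ?_
  · rcases (hs T).1 hT with rfl | rfl
    exacts [hU, hV]
  · rw [hS x]
    constructor
    · rintro ⟨h₁, h₂⟩
      refine ⟨hX.subset U hU x h₁, fun T hT => ?_⟩
      rcases (hs T).1 hT with rfl | rfl
      exacts [h₁, h₂]
    · exact fun h => ⟨h.2 U ((hs U).2 (.inl rfl)), h.2 V ((hs V).2 (.inr rfl))⟩

omit hM in
theorem isCl_of_isDiff {U A : M} (hU : IsOp Cov U) (hA : IsDiff A X U) : IsCl X Cov A := by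
  refine ⟨fun z hz => ((hA z).1 hz).1, U, fun z => ?_, hU⟩
  rw [hA z]
  have := hX.subset U hU z
  tauto

theorem isNormalRing (hn : IsWeaklyNormal X Cov) {C : M} (hC : IsClFamily X Cov C) :
    IsNormalRing X C := by
  refine ⟨⟨?_, ?_, ?_, ?_, ?_⟩, ?_, ?_⟩
  · exact fun A hA => ((hC A).1 hA).1
  · exact fun e he => (hC e).2 (hX.isCl_of_isDiff (hX.isOp_univ hM) fun z => by simp [he z])
  · obtain ⟨e, he⟩ := hM.exists_empty
    exact (hC X).2 (hX.isCl_of_isDiff (hX.isOp_of_isEmptySet he) fun z => by simp [he z])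
  · intro A B hA hB S hS
    obtain ⟨hAX, U, hU, hUo⟩ := (hC A).1 hA
    obtain ⟨hBX, V, hV, hVo⟩ := (hC B).1 hB
    obtain ⟨T, hT⟩ := hM.exists_inter U V
    refine (hC S).2 (hX.isCl_of_isDiff (hX.isOp_inter hM hUo hVo hT) fun z => ?_)
    have h₁ := hAX z
    have h₂ := hBX z
    rw [hS z, hT z, hU z, hV z]
    tauto
  · intro A B hA hB S hS
    obtain ⟨hAX, U, hU, hUo⟩ := (hC A).1 hA
    obtain ⟨hBX, V, hV, hVo⟩ := (hC B).1 hB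
    obtain ⟨T, hT⟩ := hM.exists_union U V
    refine (hC S).2 (hX.isCl_of_isDiff (hX.isOp_union hM hUo hVo hT) fun z => ?_)
    have h₁ := hAX z
    have h₂ := hBX z
    rw [hS z, hT z, hU z, hV z]
    tauto
  · intro x A hx hA hxA
    obtain ⟨s, hs⟩ := hM.exists_singleton x
    obtain ⟨V₁, V₂, -, hV₂, hdisj, hs₁, hA₂⟩ := hn s A (.inl ⟨x, hx, hs⟩) (.inr ((hC A).1 hA))
      (fun z hz => hxA ((hs z).1 hz.1 ▸ hz.2))
    obtain ⟨B, hB⟩ := hM.exists_diff X V₂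
    refine ⟨B, (hC B).2 (hX.isCl_of_isDiff hV₂ hB), (hB x).2 ⟨hx, fun h => ?_⟩, fun z hz => ?_⟩
    · exact hdisj x ⟨hs₁ x ((hs x).2 rfl), h⟩
    · exact ((hB z).1 hz.2).2 (hA₂ z hz.1)
  · intro A B hA hB hAB
    obtain ⟨V₁, V₂, hV₁, hV₂, hdisj, hA₁, hB₂⟩ :=
      hn A B (.inr ((hC A).1 hA)) (.inr ((hC B).1 hB)) hAB
    obtain ⟨A', hA'⟩ := hM.exists_diff X V₁
    obtain ⟨B', hB'⟩ := hM.exists_diff X V₂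
    refine ⟨A', B', (hC A').2 (hX.isCl_of_isDiff hV₁ hA'), (hC B').2 (hX.isCl_of_isDiff hV₂ hB'),
      fun z hz => ((hA' z).1 hz.2).2 (hA₁ z hz.1), fun z hz => ((hB' z).1 hz.2).2 (hB₂ z hz.1),
      fun z => ?_⟩
    have := hdisj z
    rw [hA' z, hB' z]
    tauto

end IsGenTop

/-! ### Filters and ultrafilters in a ring of sets -/

theorem IsFilterIn.not_isDisjoint (hM : IsModelZF M) {C F A B : M} (hF : IsFilterIn C F)
    (hA : A ∈ₘ F) (hB : B ∈ₘ F) : ¬ IsDisjoint A B := by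
  intro h
  obtain ⟨I, hI⟩ := hM.exists_inter A B
  exact hF.proper I (fun z hz => h z ((hI z).1 hz)) (hF.inter A B hA hB I hI)

theorem IsFilterIn.univ_mem {X C F : M} (hC : IsRingOfSets X C) (hF : IsFilterIn C F) :
    X ∈ₘ F := by
  obtain ⟨A, hA⟩ := hF.nonempty
  exact hF.upward A X hA hC.univ (hC.subset A (hF.subset A hA))

/-- Otherwise `p` and `A` would generate a larger filter. -/
theorem IsUltrafilterIn.mem_of_forall_not_isDisjoint (hM : IsModelZF M) {X C p A : M}
    (hC : IsRingOfSets X C) (hp : IsUltrafilterIn C p) (hA : A ∈ₘ C)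
    (h : ∀ B, B ∈ₘ p → ¬ IsDisjoint A B) : A ∈ₘ p := by
  obtain ⟨F, hF⟩ := hM.sep C (fun D => ∃ B, B ∈ₘ p ∧ ∀ z, z ∈ₘ A → z ∈ₘ B → z ∈ₘ D)
  refine hp.2 F ⟨?_, ?_, ?_, ?_, ?_⟩ ?_ A ?_
  · exact fun D hD => ((hF D).1 hD).1
  · obtain ⟨B, hB⟩ := hp.1.nonempty
    exact ⟨A, (hF A).2 ⟨hA, B, hB, fun z hz _ => hz⟩⟩
  · intro e he heF
    obtain ⟨-, B, hB, hBe⟩ := (hF e).1 heF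
    exact h B hB fun z hz => he z (hBe z hz.1 hz.2)
  · intro D₁ D₂ hD₁ hD₂ I hI
    obtain ⟨hD₁C, B₁, hB₁, h₁⟩ := (hF D₁).1 hD₁
    obtain ⟨hD₂C, B₂, hB₂, h₂⟩ := (hF D₂).1 hD₂
    obtain ⟨B, hB⟩ := hM.exists_inter B₁ B₂
    refine (hF I).2 ⟨hC.inter D₁ D₂ hD₁C hD₂C I hI, B, hp.1.inter B₁ B₂ hB₁ hB₂ B hB,
      fun z hzA hzB => ?_⟩
    obtain ⟨hz₁, hz₂⟩ := (hB z).1 hzB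
    exact (hI z).2 ⟨h₁ z hzA hz₁, h₂ z hzA hz₂⟩
  · intro D D' hD hD' hDD'
    obtain ⟨-, B, hB, h₁⟩ := (hF D).1 hD
    exact (hF D').2 ⟨hD', B, hB, fun z hz hzB => hDD' z (h₁ z hz hzB)⟩
  · exact fun B hB => (hF B).2 ⟨hp.1.subset B hB, B, hB, fun _ _ hz => hz⟩
  · obtain ⟨B, hB⟩ := hp.1.nonempty
    exact (hF A).2 ⟨hA, B, hB, fun z hz _ => hz⟩

/-- Ultrafilters in a ring of sets are prime. -/
theorem IsUltrafilterIn.mem_or_mem (hM : IsModelZF M) {X C p A B S : M} (hC : IsRingOfSets X C)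
    (hp : IsUltrafilterIn C p) (hA : A ∈ₘ C) (hB : B ∈ₘ C) (hS : IsUnion S A B) (hSp : S ∈ₘ p) :
    A ∈ₘ p ∨ B ∈ₘ p := by
  by_contra! h
  have key : ∀ D, D ∈ₘ C → ¬ D ∈ₘ p → ∃ E, E ∈ₘ p ∧ IsDisjoint D E := by
    intro D hD hDp
    by_contra! hE
    exact hDp (hp.mem_of_forall_not_isDisjoint hM hC hD hE)
  obtain ⟨D₁, hD₁, h₁⟩ := key A hA h.1
  obtain ⟨D₂, hD₂, h₂⟩ := key B hB h.2
  obtain ⟨I, hI⟩ := hM.exists_inter D₁ D₂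
  refine hp.1.not_isDisjoint hM hSp (hp.1.inter D₁ D₂ hD₁ hD₂ I hI) fun z ⟨hz, hzI⟩ => ?_
  obtain ⟨hz₁, hz₂⟩ := (hI z).1 hzI
  rcases (hS z).1 hz with hz | hz
  exacts [h₁ z ⟨hz, hz₁⟩, h₂ z ⟨hz, hz₂⟩]

theorem IsNormalRing.isUltrafilterIn_wallmanMap (hM : IsModelZF M) {X C x p : M}
    (hC : IsNormalRing X C) (hx : x ∈ₘ X) (hp : WallmanMap C x p) : IsUltrafilterIn C p := by
  refine ⟨⟨?_, ?_, ?_, ?_, ?_⟩, ?_⟩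
  · exact fun A hA => ((hp A).1 hA).1
  · exact ⟨X, (hp X).2 ⟨hC.univ, hx⟩⟩
  · exact fun e he hep => he x ((hp e).1 hep).2
  · intro A B hA hB I hI
    obtain ⟨hA, hxA⟩ := (hp A).1 hA
    obtain ⟨hB, hxB⟩ := (hp B).1 hB
    exact (hp I).2 ⟨hC.inter A B hA hB I hI, (hI x).2 ⟨hxA, hxB⟩⟩
  · exact fun A B hA hB hAB => (hp B).2 ⟨hB, hAB x ((hp A).1 hA).2⟩
  · intro F hF hpF A hA
    refine (hp A).2 ⟨hF.subset A hA, ?_⟩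
    by_contra hxA
    obtain ⟨B, hB, hxB, hAB⟩ := hC.separates x A hx (hF.subset A hA) hxA
    have hBF := hpF B ((hp B).2 ⟨hB, hxB⟩)
    exact hF.not_isDisjoint hM hA hBF hAB

theorem isRingOfSets_powerset {X P : M} (hP : IsPowerset P X) : IsRingOfSets X P where
  subset U hU := (hP U).1 hU
  empty e he := (hP e).2 fun z hz => (he z hz).elim
  univ := (hP X).2 fun _ hz => hz
  union U V hU hV S hS := (hP S).2 fun z hz =>
    ((hS z).1 hz).elim ((hP U).1 hU z) ((hP V).1 hV z)
  inter U _ hU _ S hS := (hP S).2 fun z hz => (hP U).1 hU z ((hS z).1 hz).1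

/-- The ultrafilter theorem for normal rings of sets. If `p` is an ultrafilter on `X` that contains
`F`, then `p ∩ C` is a prime filter in `C`, which need not be maximal. By normality the members of
`C` that meet all members of `p ∩ C` form a filter, and this filter is maximal. -/
theorem IsNormalRing.exists_isUltrafilterIn (hM : IsModelZF M) (hUFT : UFT M) {X C F : M}
    (hC : IsNormalRing X C) (hF : IsFilterIn C F) : ∃ q, IsUltrafilterIn C q ∧ F ⊆ₘ q := by
  obtain ⟨P, hP⟩ := hM.powerset X
  have hPr := isRingOfSets_powerset hP
  obtain ⟨F', hF'⟩ := hM.sep P (fun S => ∃ A, A ∈ₘ F ∧ A ⊆ₘ S)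
  have hCP : ∀ A, A ∈ₘ C → A ∈ₘ P := fun A hA => (hP A).2 (hC.subset A hA)
  have hFF' : F ⊆ₘ F' := fun A hA => (hF' A).2 ⟨hCP A (hF.subset A hA), A, hA, fun _ h => h⟩
  have hFil : IsFilterIn P F' := by
    refine ⟨fun S hS => ((hF' S).1 hS).1, ?_, ?_, ?_, ?_⟩
    · exact hF.nonempty.imp hFF'
    · intro e he heF
      obtain ⟨-, A, hA, hAe⟩ := (hF' e).1 heF
      exact hF.proper A (fun z hz => he z (hAe z hz)) hA
    · intro S T hS hT I hI
      obtain ⟨hSP, A, hA, hAS⟩ := (hF' S).1 hS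
      obtain ⟨hTP, B, hB, hBT⟩ := (hF' T).1 hT
      obtain ⟨D, hD⟩ := hM.exists_inter A B
      refine (hF' I).2 ⟨hPr.inter S T hSP hTP I hI, D, hF.inter A B hA hB D hD, fun z hz => ?_⟩
      obtain ⟨hzA, hzB⟩ := (hD z).1 hz
      exact (hI z).2 ⟨hAS z hzA, hBT z hzB⟩
    · intro S T hS hT hST
      obtain ⟨-, A, hA, hAS⟩ := (hF' S).1 hS
      exact (hF' T).2 ⟨hT, A, hA, fun z hz => hST z (hAS z hz)⟩
  obtain ⟨p, hp, hF'p⟩ := hUFT X P hP F' hFil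
  obtain ⟨q, hq⟩ := hM.sep C (fun A => ∀ B, B ∈ₘ p → B ∈ₘ C → ¬ IsDisjoint A B)
  have hpq : ∀ A, A ∈ₘ p → A ∈ₘ C → A ∈ₘ q := fun A hA hAC =>
    (hq A).2 ⟨hAC, fun B hB _ => hp.1.not_isDisjoint hM hA hB⟩
  have hXp : X ∈ₘ p := hp.1.univ_mem hPr
  refine ⟨q, ⟨⟨?_, ?_, ?_, ?_, ?_⟩, ?_⟩, ?_⟩
  · exact fun A hA => ((hq A).1 hA).1
  · exact ⟨X, hpq X hXp hC.univ⟩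
  · exact fun e he heq => ((hq e).1 heq).2 X hXp hC.univ fun z hz => he z hz.1
  · intro A₁ A₂ hA₁ hA₂ I hI
    obtain ⟨hA₁C, h₁⟩ := (hq A₁).1 hA₁
    obtain ⟨hA₂C, h₂⟩ := (hq A₂).1 hA₂
    refine (hq I).2 ⟨hC.inter A₁ A₂ hA₁C hA₂C I hI, fun B hBp hBC hdisj => ?_⟩
    obtain ⟨B₁, hB₁⟩ := hM.exists_inter A₁ B
    obtain ⟨B₂, hB₂⟩ := hM.exists_inter A₂ B
    obtain ⟨D₁, D₂, hD₁, hD₂, hd₁, hd₂, hX⟩ := hC.normal B₁ B₂ (hC.inter A₁ B hA₁C hBC B₁ hB₁)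
      (hC.inter A₂ B hA₂C hBC B₂ hB₂) (fun z ⟨hz₁, hz₂⟩ => hdisj z
        ⟨(hI z).2 ⟨((hB₁ z).1 hz₁).1, ((hB₂ z).1 hz₂).1⟩, ((hB₁ z).1 hz₁).2⟩)
    -- If `B' = A ∩ B` misses `D ∈ p`, then `A` misses `B ∩ D ∈ p`.
    have key : ∀ A B' D, (∀ B, B ∈ₘ p → B ∈ₘ C → ¬ IsDisjoint A B) → IsInter B' A B →
        IsDisjoint B' D → D ∈ₘ C → ¬ D ∈ₘ p := by
      intro A B' D hA hB' hd hD hDp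
      obtain ⟨J, hJ⟩ := hM.exists_inter B D
      refine hA J (hp.1.inter B D hBp hDp J hJ) (hC.inter B D hBC hD J hJ) fun z ⟨hzA, hzJ⟩ => ?_
      obtain ⟨hzB, hzD⟩ := (hJ z).1 hzJ
      exact hd z ⟨(hB' z).2 ⟨hzA, hzB⟩, hzD⟩
    rcases hp.mem_or_mem hM hPr (hCP D₁ hD₁) (hCP D₂ hD₂) hX hXp with h | h
    exacts [key A₁ B₁ D₁ h₁ hB₁ hd₁ hD₁ h, key A₂ B₂ D₂ h₂ hB₂ hd₂ hD₂ h]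
  · intro A B hA hB hAB
    exact (hq B).2 ⟨hB, fun D hD hDC hd => ((hq A).1 hA).2 D hD hDC fun z hz =>
      hd z ⟨hAB z hz.1, hz.2⟩⟩
  · intro G hG hqG A hA
    exact (hq A).2 ⟨hG.subset A hA, fun B hB hBC =>
      hG.not_isDisjoint hM hA (hqG B (hpq B hB hBC))⟩
  · exact fun A hA => hpq A (hF'p A (hFF' A hA)) (hF.subset A hA)

end Filters

/-! ### The Wallman space of a normal ring -/

section Compactification

variable {M : Type*} [setLang.Structure M]

/-- `V = W \ [A]`, a basic open set of the Wallman space. -/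
def IsBasicOpen (W A V : M) : Prop := ∀ p, p ∈ₘ V ↔ p ∈ₘ W ∧ ¬ A ∈ₘ p

instance {E : Type*} [EnvShape M E] (f g k : E → M) [IsEnvTerm f] [IsEnvTerm g] [IsEnvTerm k] :
    DefinableProp M (fun e => IsBasicOpen (f e) (g e) (k e)) := by
  unfold IsBasicOpen; infer_instance

instance {E : Type*} [EnvShape M E] (f g k : E → M) [IsEnvTerm f] [IsEnvTerm g] [IsEnvTerm k] :
    DefinableProp M (fun e => WallmanMap (f e) (g e) (k e)) := by
  unfold WallmanMap; infer_instance

instance {E : Type*} [EnvShape M E] (C f g k : E → M) [IsEnvTerm C] [IsEnvTerm f] [IsEnvTerm g]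
    [IsEnvTerm k] :
    DefinableProp M (fun e => IsPreimage (f e) (WallmanMap (C e)) (g e) (k e)) := by
  unfold IsPreimage; infer_instance

theorem IsModelZF.exists_wallmanMap (hM : IsModelZF M) (C x : M) : ∃ p, WallmanMap C x p :=
  hM.sep C (fun A => x ∈ₘ A)

/-- `(W, τ)` is the Wallman space of `C`, and `ℬ` its closed base. -/
structure IsWallmanSpace (C W ℬ τ : M) : Prop where
  set : IsWallmanSet C W
  base : IsWallmanBase C W ℬ
  top : IsTopOfClosedBase W ℬ τ

theorem IsModelZF.exists_isWallmanSpace (hM : IsModelZF M) (C : M) :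
    ∃ W ℬ τ, IsWallmanSpace C W ℬ τ := by
  obtain ⟨P, hP⟩ := hM.powerset C
  obtain ⟨W, hW⟩ := hM.sep P (IsUltrafilterIn C)
  obtain ⟨Q, hQ⟩ := hM.powerset W
  obtain ⟨ℬ, hℬ⟩ := hM.sep Q (fun B => ∃ A, A ∈ₘ C ∧ ∀ p, p ∈ₘ B ↔ p ∈ₘ W ∧ A ∈ₘ p)
  obtain ⟨τ, hτ⟩ := hM.sep Q (fun V => V ⊆ₘ W ∧
    ∀ p, p ∈ₘ V → ∃ B, B ∈ₘ ℬ ∧ ¬ p ∈ₘ B ∧ ∀ q, q ∈ₘ W → ¬ q ∈ₘ V → q ∈ₘ B)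
  refine ⟨W, ℬ, τ, fun p => ?_, fun B => ?_, fun V => ?_⟩
  · exact (hW p).trans ⟨fun h => h.2, fun h => ⟨(hP p).2 h.1.subset, h⟩⟩
  · refine (hℬ B).trans ⟨fun h => h.2, fun h => ⟨(hQ B).2 ?_, h⟩⟩
    obtain ⟨A, _, hA⟩ := h
    exact fun p hp => ((hA p).1 hp).1
  · exact (hτ V).trans ⟨fun h => h.2, fun h => ⟨(hQ V).2 h.1, h⟩⟩

namespace IsWallmanSpace

variable {C W ℬ τ : M} (h : IsWallmanSpace C W ℬ τ)
include h

theorem mem_top_of_isBasicOpen (hM : IsModelZF M) {A V : M} (hA : A ∈ₘ C)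
    (hV : IsBasicOpen W A V) : V ∈ₘ τ := by
  refine (h.top V).2 ⟨fun p hp => ((hV p).1 hp).1, fun p hp => ?_⟩
  obtain ⟨B, hB⟩ := hM.sep W (fun q => A ∈ₘ q)
  refine ⟨B, (h.base B).2 ⟨A, hA, hB⟩, fun hpB => ((hV p).1 hp).2 ((hB p).1 hpB).2,
    fun q hq hqV => (hB q).2 ⟨hq, ?_⟩⟩
  by_contra hAq
  exact hqV ((hV q).2 ⟨hq, hAq⟩)

theorem exists_of_mem_top {V p : M} (hV : V ∈ₘ τ) (hp : p ∈ₘ V) :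
    ∃ A, A ∈ₘ C ∧ ¬ A ∈ₘ p ∧ ∀ q, q ∈ₘ W → ¬ q ∈ₘ V → A ∈ₘ q := by
  obtain ⟨hVW, hV⟩ := (h.top V).1 hV
  obtain ⟨B, hB, hpB, hBV⟩ := hV p hp
  obtain ⟨A, hA, hAB⟩ := (h.base B).1 hB
  exact ⟨A, hA, fun hAp => hpB ((hAB p).2 ⟨hVW p hp, hAp⟩),
    fun q hq hqV => ((hAB q).1 (hBV q hq hqV)).2⟩

/-- If the open cover `𝒱` has no finite subcover, then the `A ∈ C` with `W \ ⋃ 𝒰 ⊆ [A]` for some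
finite `𝒰 ⊆ 𝒱` form a filter, and an ultrafilter that contains it lies in no member of `𝒱`. -/
theorem isCompactSpace (hM : IsModelZF M) (hUFT : UFT M) {X : M} (hC : IsNormalRing X C) :
    IsCompactSpace W τ := by
  intro 𝒱 h𝒱 hcov
  by_contra hfin
  obtain ⟨F, hF⟩ := hM.sep C (fun A => ∃ 𝒰, 𝒰 ⊆ₘ 𝒱 ∧ IsFinite 𝒰 ∧
    ∀ q, q ∈ₘ W → (∀ U, U ∈ₘ 𝒰 → ¬ q ∈ₘ U) → A ∈ₘ q)
  have hFil : IsFilterIn C F := by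
    refine ⟨fun A hA => ((hF A).1 hA).1, ?_, ?_, ?_, ?_⟩
    · obtain ⟨e, he⟩ := hM.exists_empty
      exact ⟨X, (hF X).2 ⟨hC.univ, e, fun z hz => (he z hz).elim, isFinite_of_isEmptySet he,
        fun q hq _ => ((h.set q).1 hq).1.univ_mem hC.toIsRingOfSets⟩⟩
    · intro e he heF
      obtain ⟨-, 𝒰, h𝒰, h𝒰fin, h𝒰e⟩ := (hF e).1 heF
      refine hfin ⟨𝒰, h𝒰, h𝒰fin, fun q hq => ?_⟩
      by_contra! hq'
      exact ((h.set q).1 hq).1.proper e he (h𝒰e q hq hq')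
    · intro A₁ A₂ hA₁ hA₂ I hI
      obtain ⟨hA₁C, 𝒰₁, h𝒰₁, hfin₁, h₁⟩ := (hF A₁).1 hA₁
      obtain ⟨hA₂C, 𝒰₂, h𝒰₂, hfin₂, h₂⟩ := (hF A₂).1 hA₂
      obtain ⟨𝒰, h𝒰⟩ := hM.exists_union 𝒰₁ 𝒰₂
      exact (hF I).2 ⟨hC.inter A₁ A₂ hA₁C hA₂C I hI, 𝒰,
        fun U hU => ((h𝒰 U).1 hU).elim (h𝒰₁ U) (h𝒰₂ U), hfin₁.union hM hfin₂ h𝒰,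
        fun q hq hqU => ((h.set q).1 hq).1.inter A₁ A₂
          (h₁ q hq fun U hU => hqU U ((h𝒰 U).2 (.inl hU)))
          (h₂ q hq fun U hU => hqU U ((h𝒰 U).2 (.inr hU))) I hI⟩
    · intro A B hA hB hAB
      obtain ⟨-, 𝒰, h𝒰, hfin, h₁⟩ := (hF A).1 hA
      exact (hF B).2 ⟨hB, 𝒰, h𝒰, hfin,
        fun q hq hqU => ((h.set q).1 hq).1.upward A B (h₁ q hq hqU) hB hAB⟩
  obtain ⟨q, hq, hFq⟩ := hC.exists_isUltrafilterIn hM hUFT hFil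
  obtain ⟨V, hV, hqV⟩ := hcov q ((h.set q).2 hq)
  obtain ⟨A, hA, hAq, hAV⟩ := h.exists_of_mem_top (h𝒱 V hV) hqV
  obtain ⟨s, hs⟩ := hM.exists_singleton V
  exact hAq (hFq A ((hF A).2 ⟨hA, s, fun z hz => (hs z).1 hz ▸ hV, isFinite_of_isSingleton hM hs,
    fun r hr hrs => hAV r hr (hrs V ((hs V).2 rfl))⟩))

/-- The closure in the Wallman space of the image of `A ∈ C` is `[A]`. -/
theorem inClosureImage_iff (hM : IsModelZF M) {X A p : M} (hC : IsNormalRing X C) (hA : A ∈ₘ C)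
    (hp : p ∈ₘ W) : InClosureImage τ (WallmanMap C) A p ↔ A ∈ₘ p := by
  constructor
  · intro hcl
    by_contra hAp
    obtain ⟨V, hV⟩ := hM.sep W (fun q => ¬ A ∈ₘ q)
    obtain ⟨x, hxA, q, hq, hqV⟩ := hcl V (h.mem_top_of_isBasicOpen hM hA hV)
      ((hV p).2 ⟨hp, hAp⟩)
    exact ((hV q).1 hqV).2 ((hq A).2 ⟨hA, hxA⟩)
  · intro hAp V hV hpV
    by_contra! hdisj
    obtain ⟨D, hD, hDp, hDV⟩ := h.exists_of_mem_top hV hpV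
    refine hDp (((h.set p).1 hp).1.upward A D hAp hD fun x hx => ?_)
    obtain ⟨q, hq⟩ := hM.exists_wallmanMap C x
    exact ((hq D).1 (hDV q ((h.set q).2 (hC.isUltrafilterIn_wallmanMap hM (hC.subset A hA x hx) hq))
      (hdisj x hx q hq))).2

/-- `Ex(X \ A) = W \ [A]` for `A ∈ C`. -/
theorem isEx_iff (hM : IsModelZF M) {X U A E : M} (hC : IsNormalRing X C) (hA : A ∈ₘ C)
    (hU : IsDiff A X U) : IsEx X W τ (WallmanMap C) U E ↔ IsBasicOpen W A E := by
  constructor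
  · rintro ⟨S, hS, hE⟩ p
    have : S = A := hM.extensionality _ _ fun z => (hS z).trans (hU z).symm
    subst this
    exact (hE p).trans (and_congr_right fun hp => not_congr (h.inClosureImage_iff hM hC hA hp))
  · intro hE
    exact ⟨A, hU, fun p => (hE p).trans
      (and_congr_right fun hp => not_congr (h.inClosureImage_iff hM hC hA hp).symm)⟩

/-- `w⁻¹(W \ [A]) = X \ A` for `A ∈ C`. -/
theorem isPreimage_iff (hM : IsModelZF M) {X A E P : M} (hC : IsNormalRing X C) (hA : A ∈ₘ C)
    (hE : IsBasicOpen W A E) : IsPreimage X (WallmanMap C) E P ↔ IsDiff P X A := by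
  refine forall_congr' fun x => ?_
  suffices hx : x ∈ₘ X → ((∃ p, WallmanMap C x p ∧ p ∈ₘ E) ↔ ¬ x ∈ₘ A) by
    rw [and_congr_right hx]
  intro hx
  constructor
  · rintro ⟨p, hp, hpE⟩ hxA
    exact ((hE p).1 hpE).2 ((hp A).2 ⟨hA, hxA⟩)
  · intro hxA
    obtain ⟨p, hp⟩ := hM.exists_wallmanMap C x
    exact ⟨p, hp, (hE p).2 ⟨(h.set p).2 (hC.isUltrafilterIn_wallmanMap hM hx hp),
      fun hAp => hxA ((hp A).1 hAp).2⟩⟩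

/-- The sets `W \ [A]` form a ring, since `[A ∩ B] = [A] ∩ [B]` and `[A ∪ B] = [A] ∪ [B]`. -/
theorem isRingOfSets (hM : IsModelZF M) {X R : M} (hC : IsRingOfSets X C)
    (hR : ∀ E, E ∈ₘ R ↔ ∃ A, A ∈ₘ C ∧ IsBasicOpen W A E) : IsRingOfSets W R := by
  refine ⟨?_, ?_, ?_, ?_, ?_⟩
  · intro E hE p hp
    obtain ⟨A, -, hA⟩ := (hR E).1 hE
    exact ((hA p).1 hp).1
  · intro e he
    exact (hR e).2 ⟨X, hC.univ, fun p => ⟨fun hp => (he p hp).elim,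
      fun hp => (hp.2 (((h.set p).1 hp.1).1.univ_mem hC)).elim⟩⟩
  · obtain ⟨e, he⟩ := hM.exists_empty
    exact (hR W).2 ⟨e, hC.empty e he, fun p =>
      ⟨fun hp => ⟨hp, ((h.set p).1 hp).1.proper e he⟩, fun hp => hp.1⟩⟩
  · intro E E' hE hE' S hS
    obtain ⟨A, hA, hAE⟩ := (hR E).1 hE
    obtain ⟨A', hA', hAE'⟩ := (hR E').1 hE'
    obtain ⟨D, hD⟩ := hM.exists_inter A A'
    have hDC := hC.inter A A' hA hA' D hD
    refine (hR S).2 ⟨D, hDC, fun p => ?_⟩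
    rw [hS p, hAE p, hAE' p, ← and_or_left]
    refine and_congr_right fun hp => ?_
    have hF := ((h.set p).1 hp).1
    have h₁ : D ∈ₘ p ↔ A ∈ₘ p ∧ A' ∈ₘ p :=
      ⟨fun h => ⟨hF.upward D A h hA fun z hz => ((hD z).1 hz).1,
        hF.upward D A' h hA' fun z hz => ((hD z).1 hz).2⟩, fun h => hF.inter A A' h.1 h.2 D hD⟩
    rw [h₁]
    tauto
  · intro E E' hE hE' S hS
    obtain ⟨A, hA, hAE⟩ := (hR E).1 hE
    obtain ⟨A', hA', hAE'⟩ := (hR E').1 hE'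
    obtain ⟨D, hD⟩ := hM.exists_union A A'
    have hDC := hC.union A A' hA hA' D hD
    refine (hR S).2 ⟨D, hDC, fun p => ?_⟩
    rw [hS p, hAE p, hAE' p, ← and_and_left]
    refine and_congr_right fun hp => ?_
    have hF := (h.set p).1 hp
    have h₁ : D ∈ₘ p ↔ A ∈ₘ p ∨ A' ∈ₘ p :=
      ⟨hF.mem_or_mem hM hC hA hA' hD, fun h => h.elim
        (fun h => hF.1.upward A D h hDC fun z hz => (hD z).2 (.inl hz))
        (fun h => hF.1.upward A' D h hDC fun z hz => (hD z).2 (.inr hz))⟩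
    rw [h₁]
    tauto

end IsWallmanSpace

/-! ### The two implications -/

theorem IsDiff.symm {X U A : M} (hU : U ⊆ₘ X) (h : IsDiff A X U) : IsDiff U X A := by
  intro z
  have := hU z
  rw [h z]
  tauto

theorem hasWallmanStrictCompactification_of_uft (hM : IsModelZF M) (hUFT : UFT M) {X Cov : M}
    (hX : IsGenTop X Cov) (hs : IsSmall Cov) (hn : IsWeaklyNormal X Cov) :
    HasWallmanStrictCompactification X Cov := by
  obtain ⟨PX, hPX⟩ := hM.powerset X
  obtain ⟨C, hC⟩ : ∃ C, IsClFamily X Cov C := by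
    obtain ⟨C, hC⟩ := hM.sep PX (IsCl X Cov)
    exact ⟨C, fun A => (hC A).trans ⟨fun h => h.2, fun h => ⟨(hPX A).2 h.1, h⟩⟩⟩
  have hCn := hX.isNormalRing hM hn hC
  obtain ⟨W, ℬ, τ, hW⟩ := hM.exists_isWallmanSpace C
  obtain ⟨PW, hPW⟩ := hM.powerset W
  obtain ⟨R, hR⟩ : ∃ R, ∀ E, E ∈ₘ R ↔ ∃ A, A ∈ₘ C ∧ IsBasicOpen W A E := by
    obtain ⟨R, hR⟩ := hM.sep PW (fun E => ∃ A, A ∈ₘ C ∧ IsBasicOpen W A E)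
    refine ⟨R, fun E => (hR E).trans ⟨fun h => h.2, fun h => ⟨(hPW E).2 fun p hp => ?_, h⟩⟩⟩
    obtain ⟨A, -, hA⟩ := h
    exact ((hA p).1 hp).1
  have hRr := hW.isRingOfSets hM hCn.toIsRingOfSets hR
  obtain ⟨𝒦, h𝒦⟩ := hM.exists_essFinite_families R
  have hopW : ∀ V, IsOpW X Cov W τ (WallmanMap C) V ↔ V ∈ₘ R := by
    intro V
    rw [hR V]
    constructor
    · rintro ⟨U, hU, hV⟩
      obtain ⟨A, hA⟩ := hM.exists_diff X U
      have hAC := (hC A).2 (hX.isCl_of_isDiff hU hA)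
      exact ⟨A, hAC, (hW.isEx_iff hM hCn hAC hA).1 hV⟩
    · rintro ⟨A, hAC, hV⟩
      obtain ⟨hAX, U, hU, hUo⟩ := (hC A).1 hAC
      exact ⟨U, hUo, (hW.isEx_iff hM hCn hAC (hU.symm hAX)).2 hV⟩
  have hpre : ∀ V, V ∈ₘ R → V ∈ₘ τ ∧ ∃ P, IsPreimage X (WallmanMap C) V P ∧ IsOp Cov P := by
    intro V hV
    obtain ⟨A, hAC, hA⟩ := (hR V).1 hV
    obtain ⟨-, U, hU, hUo⟩ := (hC A).1 hAC
    exact ⟨hW.mem_top_of_isBasicOpen hM hAC hA, U, (hW.isPreimage_iff hM hCn hAC hA).2 hU, hUo⟩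
  have preimage_unique : ∀ V P P', IsPreimage X (WallmanMap C) V P →
      IsPreimage X (WallmanMap C) V P' → P = P' := fun V P P' h h' =>
    hM.extensionality _ _ fun x => (h x).trans (h' x).symm
  refine ⟨C, W, ℬ, τ, 𝒦, hC, hW.set, hW.base, hW.top, hW.isCompactSpace hM hUFT hCn, ?_,
    hRr.isGenTop hM h𝒦⟩
  intro 𝒱
  rw [h𝒦 𝒱]
  constructor
  · rintro ⟨h𝒱, hess⟩
    refine ⟨⟨fun V hV => hpre V (h𝒱 V hV), ?_⟩, fun V hV => (hopW V).2 (h𝒱 V hV)⟩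
    obtain ⟨𝒬, h𝒬⟩ := hM.sep PX (fun P => ∃ V, V ∈ₘ 𝒱 ∧ IsPreimage X (WallmanMap C) V P)
    replace h𝒬 : ∀ P, P ∈ₘ 𝒬 ↔ ∃ V, V ∈ₘ 𝒱 ∧ IsPreimage X (WallmanMap C) V P := fun P =>
      (h𝒬 P).trans ⟨fun h => h.2, fun h => ⟨(hPX P).2 fun x hx => by
        obtain ⟨V, -, hV⟩ := h
        exact ((hV x).1 hx).1, h⟩⟩
    refine ⟨𝒬, (hs 𝒬).2 ⟨fun P hP => ?_, ?_⟩, h𝒬⟩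
    · obtain ⟨V, hV, hPV⟩ := (h𝒬 P).1 hP
      obtain ⟨-, P', hP', hP'o⟩ := hpre V (h𝒱 V hV)
      exact preimage_unique V P P' hPV hP' ▸ hP'o
    · obtain ⟨𝒱₀, h𝒱₀, hfin, hcov⟩ := (isEssFinite_iff hM).1 hess
      obtain ⟨𝒬₀, h𝒬₀, h𝒬fin, h𝒬cov⟩ := hfin.exists_finite_range hM 𝒬
        (fun V P => IsPreimage X (WallmanMap C) V P) (fun V hV => by
          obtain ⟨-, P, hP, -⟩ := hpre V (h𝒱 V (h𝒱₀ V hV))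
          exact ⟨P, (h𝒬 P).2 ⟨V, h𝒱₀ V hV, hP⟩, hP⟩)
      refine (isEssFinite_iff hM).2 ⟨𝒬₀, h𝒬₀, h𝒬fin, fun P hP x hx => ?_⟩
      obtain ⟨V, hV, hPV⟩ := (h𝒬 P).1 hP
      obtain ⟨hxX, p, hp, hpV⟩ := (hPV x).1 hx
      obtain ⟨V', hV', hpV'⟩ := hcov V hV p hpV
      obtain ⟨P', hP', hPV'⟩ := h𝒬cov V' hV'
      exact ⟨P', hP', (hPV' x).2 ⟨hxX, p, hp, hpV'⟩⟩
  · rintro ⟨⟨-, 𝒬, h𝒬Cov, h𝒬⟩, h𝒱⟩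
    replace h𝒱 : 𝒱 ⊆ₘ R := fun V hV => (hopW V).1 (h𝒱 V hV)
    refine ⟨h𝒱, (isEssFinite_iff hM).2 ?_⟩
    obtain ⟨𝒬₀, h𝒬₀, hfin, hcov⟩ := (isEssFinite_iff hM).1 ((hs 𝒬).1 h𝒬Cov).2
    obtain ⟨𝒱₀, h𝒱₀, h𝒱fin, h𝒱cov⟩ := hfin.exists_finite_range hM 𝒱
      (fun P V => IsPreimage X (WallmanMap C) V P) (fun P hP => (h𝒬 P).1 (h𝒬₀ P hP))
    refine ⟨𝒱₀, h𝒱₀, h𝒱fin, fun V hV p hp => ?_⟩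
    -- `V = W \ [A]` and the union of the finite subfamily is `W \ [B]`; comparing the preimages
    -- in `X` gives `B ⊆ A`.
    obtain ⟨T, hT⟩ := hM.union 𝒱₀
    obtain ⟨A, hAC, hA⟩ := (hR V).1 (h𝒱 V hV)
    obtain ⟨B, hBC, hB⟩ :=
      (hR T).1 (hRr.finite_union hM h𝒱fin (fun V hV => h𝒱 V (h𝒱₀ V hV)) hT)
    rw [← hT p, hB p]
    obtain ⟨hpW, hAp⟩ := (hA p).1 hp
    refine ⟨hpW, fun hBp => hAp (((hW.set p).1 hpW).1.upward B A hBp hAC fun x hxB => ?_)⟩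
    by_contra hxA
    have hxX := hCn.subset B hBC x hxB
    obtain ⟨P, hP⟩ := hM.exists_diff X A
    obtain ⟨P', hP', hxP'⟩ := hcov P
      ((h𝒬 P).2 ⟨V, hV, (hW.isPreimage_iff hM hCn hAC hA).2 hP⟩) x ((hP x).2 ⟨hxX, hxA⟩)
    obtain ⟨V', hV', hPV'⟩ := h𝒱cov P' hP'
    obtain ⟨-, q, hq, hqV'⟩ := (hPV' x).1 hxP'
    exact ((hB q).1 ((hT q).2 ⟨V', hV', hqV'⟩)).2 ((hq B).2 ⟨hBC, hxB⟩)

/-- A filter `F` on `X` that lies in no ultrafilter yields the open cover of the Wallman space of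
the discrete small space `X` by the sets `W \ [A]`, `A ∈ F`; it has no finite subcover, since the
principal ultrafilter of a point of a finite intersection of members of `F` is left uncovered. -/
theorem uft_of_hasWallmanStrictCompactification (hM : IsModelZF M)
    (H : ∀ X Cov : M, IsGenTop X Cov → IsSmall Cov → IsWeaklyNormal X Cov →
      HasWallmanStrictCompactification X Cov) : UFT M := by
  intro X P hP F hF
  have hPr := isRingOfSets_powerset hP
  obtain ⟨Cov, hCov⟩ := hM.exists_essFinite_families P
  have hop : ∀ U, IsOp Cov U ↔ U ⊆ₘ X := fun U => (isOp_iff_mem hM hCov U).trans (hP U)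
  have hX := hPr.isGenTop hM hCov
  have hsub : ∀ A, IsPointOrCl X Cov A → A ⊆ₘ X := by
    rintro A (⟨x, hx, hA⟩ | hA)
    exacts [fun z hz => (hA z).1 hz ▸ hx, hA.1]
  have hn : IsWeaklyNormal X Cov := fun A₁ A₂ h₁ h₂ hdisj =>
    ⟨A₁, A₂, (hop A₁).2 (hsub A₁ h₁), (hop A₂).2 (hsub A₂ h₂), hdisj, fun _ h => h, fun _ h => h⟩
  have hs : IsSmall Cov := fun 𝒰 => (hCov 𝒰).trans <|
    and_congr_left fun _ => forall_congr' fun U => imp_congr_right fun _ =>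
      (isOp_iff_mem hM hCov U).symm
  obtain ⟨C, W, ℬ, τ, 𝒦, hC, hWset, hbase, htop, hcpt, -, -⟩ := H X Cov hX hs hn
  have hCn := hX.isNormalRing hM hn hC
  -- All subsets are closed, so the Wallman space consists of the ultrafilters on `X`.
  obtain rfl : C = P := by
    refine hM.extensionality _ _ fun A => ((hC A).trans ⟨fun h => h.1, fun h => ⟨h, ?_⟩⟩).trans
      (hP A).symm
    obtain ⟨U, hU⟩ := hM.exists_diff X A
    exact ⟨U, hU, (hop U).2 fun z hz => ((hU z).1 hz).1⟩
  have hW : IsWallmanSpace C W ℬ τ := ⟨hWset, hbase, htop⟩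
  by_contra! hno
  obtain ⟨𝒱, h𝒱⟩ := hM.sep τ (fun V => ∃ A, A ∈ₘ F ∧ IsBasicOpen W A V)
  obtain ⟨𝒰, h𝒰, hfin, hcov⟩ := hcpt 𝒱 (fun V hV => ((h𝒱 V).1 hV).1) fun p hp => by
    obtain ⟨A, hA, hAp⟩ : ∃ A, A ∈ₘ F ∧ ¬ A ∈ₘ p := by
      by_contra! hFp
      exact hno p ((hW.set p).1 hp) hFp
    obtain ⟨V, hV⟩ := hM.sep W (fun q => ¬ A ∈ₘ q)
    exact ⟨V, (h𝒱 V).2 ⟨hW.mem_top_of_isBasicOpen hM (hF.subset A hA) hV, A, hA, hV⟩,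
      (hV p).2 ⟨hp, hAp⟩⟩
  -- Finitely many sets `W \ [A]` with `A ∈ F` miss all points of some `[A]` with `A ∈ F`.
  obtain ⟨A, hA, hA𝒰⟩ : ∃ A, A ∈ₘ F ∧ ∀ V, V ∈ₘ 𝒰 → ∀ p, p ∈ₘ V → ¬ A ∈ₘ p := by
    refine hfin.induction hM (fun 𝒰 => ∃ A, A ∈ₘ F ∧ ∀ V, V ∈ₘ 𝒰 → ∀ p, p ∈ₘ V → ¬ A ∈ₘ p) ?_ ?_
    · intro e he
      exact hF.nonempty.imp fun A hA => ⟨hA, fun V hV => (he V hV).elim⟩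
    · rintro B V B₁ hB hV hB₁ ⟨A, hA, hAB⟩
      obtain ⟨-, A', hA', hVA'⟩ := (h𝒱 V).1 (h𝒰 V hV)
      obtain ⟨D, hD⟩ := hM.exists_inter A A'
      refine ⟨D, hF.inter A A' hA hA' D hD, fun V' hV' p hp hDp => ?_⟩
      have hfil : ∀ {p}, p ∈ₘ W → IsFilterIn C p := fun hp => ((hW.set _).1 hp).1
      rcases (hB₁ V').1 hV' with rfl | hV'
      · obtain ⟨hpW, hA'p⟩ := (hVA' p).1 hp
        exact hA'p ((hfil hpW).upward D A' hDp (hF.subset A' hA') fun z hz => ((hD z).1 hz).2)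
      · obtain ⟨-, A'', -, hVA''⟩ := (h𝒱 V').1 (h𝒰 V' (hB V' hV'))
        exact hAB V' hV' p hp ((hfil ((hVA'' p).1 hp).1).upward D A hDp (hF.subset A hA)
          fun z hz => ((hD z).1 hz).1)
  obtain ⟨x, hx⟩ : ∃ x, x ∈ₘ A := by
    by_contra! he
    exact hF.proper A he hA
  obtain ⟨p, hp⟩ := hM.exists_wallmanMap C x
  have hAC := hF.subset A hA
  obtain ⟨U, hU, hpU⟩ := hcov p
    ((hW.set p).2 (hCn.isUltrafilterIn_wallmanMap hM (hCn.subset A hAC x hx) hp))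
  exact hA𝒰 U hU p hpU ((hp A).2 ⟨hAC, hx⟩)

end Compactification
end InZF

/-- In ZF, the ultrafilter theorem is equivalent to the statement that every weakly normal small
generalized topological space has its Wallman strict compactification: the equivalence holds in
every model `M` of ZF. -/
theorem theorem5p23 (M : Type*) [InZF.setLang.Structure M] (hM : InZF.IsModelZF M) :
    InZF.UFT M ↔
      ∀ X Cov : M, InZF.IsGenTop X Cov → InZF.IsSmall Cov → InZF.IsWeaklyNormal X Cov →
        InZF.HasWallmanStrictCompactification X Cov :=
  ⟨fun h _ _ hX hs hn => InZF.hasWallmanStrictCompactification_of_uft hM h hX hs hn,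
    InZF.uft_of_hasWallmanStrictCompactification hM⟩
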